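/- Let $\Sigma=\{0,1\}$. Oracles are sets $D\subseteq\Sigma^*$. An oracle Turing machine is called polynomial-time if one polynomial bounds its running time on all inputs, all computation paths and all oracles; a query takes one step and erases the query tape. For an oracle $O$, let $\mathrm{P}^O$, $\mathrm{NP}^O$ and $\mathrm{FP}^O$ be the classes of the languages accepted by deterministic polynomial-time oracle machines, the languages accepted by nondeterministic polynomial-time oracle machines, and the total functions $\Sigma^*\to\Sigma^*$ computed by deterministic polynomial-time oracle transducers, each with oracle $O$. Let $\langle\cdot\rangle$ be an injective, polynomial-time computable, polynomial-time invertible function from finite sequences of words to words with $|\langle u_1,\dots,u_n\rangle|=2(|u_1|+\dots+|u_n|+n)$. Let $M_1,M_2,\dots$ be a standard enumeration of the nondeterministic polynomial-time oracle Turing machines, that is: every $M_i$ is such a machine; for all $D$ and $x$ the computation $M_i^D(x)$ stops within $|x|^i+i$ steps; for every nondeterministic polynomial-time oracle Turing machine $N$ there are infinitely many $i$ such that $L(N^D)=L(M_i^D)$ for all $D$; and there is a nondeterministic polynomial-time oracle Turing machine $N$ such that for all $D$, $i$, $x$, the machine $N^D$ accepts $\langle i,0^{|x|^i+i},x\rangle$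 if and only if $M_i^D$ accepts $x$ (here $i$ is identified with a word $w$ through $i=\sum_{j<|w|}(1+w(j))2^{|w|-1-j}$). For an oracle $D$ put $$K^D=\{\langle 0^i,0^t,x\rangle \mid i\ge 1,\ t\ge 0,\ x\in\Sigma^*,\ M_i^D(x)\text{ accepts within } t\text{ steps}\}.$$ A set $A\subseteq\Sigma^*$ has $\mathrm{P}^O$-optimal proof systems if there is a $g\in\mathrm{FP}^O$ with range $A$ such that for every $f\in\mathrm{FP}^O$ with range $A$ there are a $\pi\in\mathrm{FP}^O$ and a polynomial $p$ with $|\pi(x)|\le p(|x|)$ and $g(\pi(x))=f(x)$ for all $x\in\Sigma^*$. Theorem. There is an oracle $O$ such that (1) $\mathrm{P}^O\neq\mathrm{NP}^O$, (2) $K^O$ has $\mathrm{P}^O$-optimal proof systems, and (3) the complement $\Sigma^*\setminus K^O$ has $\mathrm{P}^O$-optimal proof systems. -/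

import Mathlib

namespace OracleComplexity

/-- Words over the alphabet `{0, 1}`; the letter `0` is `false`, the letter `1` is `true`. -/
abbrev Word := List Bool

/-- An oracle is a set of words. -/
abbrev Oracle := Set Word

/-- The word `0^n`. -/
def zeros (n : ℕ) : Word := List.replicate n false

/-- The dyadic bijection `w ↦ ∑_{i < |w|} (1 + w(i)) 2^(|w| - 1 - i)` between words and natural
numbers, evaluated from the left by the Horner scheme. -/
def wordVal (w : Word) : ℕ := w.foldl (fun n b => 2 * n + (1 + b.toNat)) 0

/-! ### Oracle Turing machines -/

/-- Tape symbols: the blank `none`, the two letters, and finitely many auxiliary symbols. -/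
abbrev TapeSymbol (Γ : Type) := Option (Bool ⊕ Γ)

/-- What a machine with `k + 1` work tapes does in one ordinary step: it goes to state `next`, on
each tape writes a symbol and then moves the head by at most one cell (`none` means that the head
stays), and appends at most one letter to the (write-only) query tape and at most one letter to the
(write-only) output tape. -/
structure Action (k : ℕ) (Q Γ : Type) where
  next : Q
  write : Fin (k + 1) → TapeSymbol Γ
  move : Fin (k + 1) → Option Turing.Dir
  query : Option Bool
  output : Option Bool

/-- The role of a state: a halting state (accepting or rejecting), a query state with the successor
states for a positive and for a negative answer of the oracle, or an ordinary state with the set of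
actions that are possible when the given symbols are scanned by the heads. -/
inductive Role (k : ℕ) (Q Γ : Type) where
  | halt (accepting : Bool) : Role k Q Γ
  | query (yes no : Q) : Role k Q Γ
  | act (δ : (Fin (k + 1) → TapeSymbol Γ) → Set (Action k Q Γ)) : Role k Q Γ

/-- Nondeterministic multi-tape oracle Turing machines (acceptors and transducers alike). -/
structure OracleTM where
  /-- The number of work tapes besides the tape `0`, which initially holds the input. -/
  k : ℕ
  State : Type
  Aux : Type
  finite_state : Finite State
  finite_aux : Finite Aux
  start : State
  role : State → Role k State Aux

namespace OracleTM

/-- Configurations. -/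
structure Cfg (M : OracleTM) where
  state : M.State
  tape : Fin (M.k + 1) → Turing.Tape (TapeSymbol M.Aux)
  query : Word
  output : Word

/-- The initial configuration on input `x`: the input is on tape `0` with the head on its first
letter, and everything else is blank. -/
def init (M : OracleTM) (x : Word) : M.Cfg where
  state := M.start
  tape := fun j => if j = 0 then Turing.Tape.mk₁ (x.map fun b => some (Sum.inl b))
    else Turing.Tape.mk₁ []
  query := []
  output := []

/-- The configuration after an ordinary step. -/
def Cfg.apply {M : OracleTM} (c : M.Cfg) (a : Action M.k M.State M.Aux) : M.Cfg where
  state := a.next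
  tape := fun j => match a.move j with
    | none => (c.tape j).write (a.write j)
    | some d => ((c.tape j).write (a.write j)).move d
  query := c.query ++ a.query.toList
  output := c.output ++ a.output.toList

open Classical in
/-- The possible successors of a configuration relative to the oracle `D`. A query takes one step,
is answered according to `D`, and erases the query tape. -/
noncomputable def next (M : OracleTM) (D : Oracle) (c : M.Cfg) : Set M.Cfg :=
  match M.role c.state with
  | .halt _ => ∅
  | .query yes no => {{ c with state := if c.query ∈ D then yes else no, query := [] }}
  | .act δ => c.apply '' δ (fun j => (c.tape j).head)

/-- `M.Reaches D n c c'`: some computation path relative to `D` leads from `c` to `c'` in exactly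
`n` steps. -/
def Reaches (M : OracleTM) (D : Oracle) : ℕ → M.Cfg → M.Cfg → Prop
  | 0, c, c' => c = c'
  | n + 1, c, c' => ∃ d ∈ M.next D c, M.Reaches D n d c'

/-- The computation `M^D(x)` stops within `n` steps (on all paths). -/
def StopsWithin (M : OracleTM) (D : Oracle) (x : Word) (n : ℕ) : Prop :=
  ∀ m c, M.Reaches D m (M.init x) c → m ≤ n

/-- `M^D(x)` accepts within `t` steps (on some path). -/
def AcceptsWithin (M : OracleTM) (D : Oracle) (x : Word) (t : ℕ) : Prop :=
  ∃ m ≤ t, ∃ c, M.Reaches D m (M.init x) c ∧ M.role c.state = .halt true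

/-- The language `L(M^D)`. -/
def lang (M : OracleTM) (D : Oracle) : Set Word := {x | ∃ t, M.AcceptsWithin D x t}

/-- Polynomial-time oracle machines: there is one polynomial time bound for all oracles, all inputs
and all paths. -/
def PolyTime (M : OracleTM) : Prop :=
  ∃ p : Polynomial ℕ, ∀ D x, M.StopsWithin D x (p.eval x.length)

/-- Deterministic machines. -/
def Deterministic (M : OracleTM) : Prop :=
  ∀ q δ, M.role q = .act δ → ∀ s, (δ s).Subsingleton

/-- `M`, used as a transducer with the oracle `D`, computes the total function `f`. -/
def Computes (M : OracleTM) (D : Oracle) (f : Word → Word) : Prop :=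
  ∀ x, ∃ m c b, M.Reaches D m (M.init x) c ∧ M.role c.state = .halt b ∧ c.output = f x

end OracleTM

/-! ### Complexity classes -/

/-- The class `P^O`. -/
def ClassP (O : Oracle) : Set (Set Word) :=
  {L | ∃ M : OracleTM, M.Deterministic ∧ M.PolyTime ∧ M.lang O = L}

/-- The class `NP^O`. -/
def ClassNP (O : Oracle) : Set (Set Word) :=
  {L | ∃ M : OracleTM, M.PolyTime ∧ M.lang O = L}

/-- The function class `FP^O`; `FP` itself is `ClassFP ∅`. -/
def ClassFP (O : Oracle) : Set (Word → Word) :=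
  {f | ∃ M : OracleTM, M.Deterministic ∧ M.PolyTime ∧ M.Computes O f}

/-! ### Proof systems -/

/-- `f` is a proof system for `A` relative to `O`. -/
def IsProofSystem (O : Oracle) (f : Word → Word) (A : Set Word) : Prop :=
  f ∈ ClassFP O ∧ Set.range f = A

/-- `f` is `P^O`-simulated by `g`. -/
def PSimulatedBy (O : Oracle) (f g : Word → Word) : Prop :=
  ∃ π ∈ ClassFP O, ∃ p : Polynomial ℕ, ∀ x, (π x).length ≤ p.eval x.length ∧ g (π x) = f x

/-- `g ∈ FP^O` is `P^O`-optimal. -/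
def IsPOptimal (O : Oracle) (g : Word → Word) : Prop :=
  g ∈ ClassFP O ∧ ∀ f ∈ ClassFP O, Set.range f = Set.range g → PSimulatedBy O f g

/-- The set `A` has `P^O`-optimal proof systems. -/
def HasPOptimalProofSystem (O : Oracle) (A : Set Word) : Prop :=
  ∃ g, IsProofSystem O g A ∧ IsPOptimal O g

/-! ### Pairing functions, standard enumerations, and the canonical complete set -/

/-- A word representing a list of words: every letter `b` is replaced by `1b`, and every word of the
list is terminated by `00`. It serves as the input and output format in `IsPairing`. -/
def listCode (l : List Word) : Word :=
  l.flatMap fun u => (u.flatMap fun b => [true, b]) ++ [false, false]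

/-- Injective, polynomial-time computable and polynomial-time invertible functions from finite
sequences of words to words with `|⟨u₁, …, uₙ⟩| = 2 (|u₁| + ⋯ + |uₙ| + n)`. -/
structure IsPairing (pair : List Word → Word) : Prop where
  injective : Function.Injective pair
  length_eq : ∀ l, (pair l).length = 2 * ((l.map List.length).sum + l.length)
  computable : ∃ f ∈ ClassFP ∅, ∀ l, f (listCode l) = pair l
  invertible : ∃ f ∈ ClassFP ∅, ∀ l, f (pair l) = listCode l

/-- Standard enumerations of the nondeterministic polynomial-time oracle Turing machines. -/
structure IsStandardEnumeration (pair : List Word → Word) (M : ℕ+ → OracleTM) : Prop where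
  polyTime : ∀ i, (M i).PolyTime
  stops : ∀ i D x, (M i).StopsWithin D x (x.length ^ (i : ℕ) + i)
  infinite : ∀ N : OracleTM, N.PolyTime → {i | ∀ D, N.lang D = (M i).lang D}.Infinite
  simulation : ∃ N : OracleTM, N.PolyTime ∧ ∀ D (i : ℕ+) x w, wordVal w = (i : ℕ) →
    (pair [w, zeros (x.length ^ (i : ℕ) + i), x] ∈ N.lang D ↔ x ∈ (M i).lang D)

/-- The set `K^D = {⟨0^i, 0^t, x⟩ | M_i^D(x) accepts within t steps}`. -/
def canonicalK (pair : List Word → Word) (M : ℕ+ → OracleTM) (D : Oracle) : Set Word :=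
  {z | ∃ (i : ℕ+) (t : ℕ) (x : Word),
    z = pair [zeros i, zeros t, x] ∧ (M i).AcceptsWithin D x t}

end OracleComplexity

/-!
The oracle `O = codingOracle E (Sound E A) X` is built by recursion on the length of words from a set
`X` of words, where `A` is the pair consisting of `K^O` and its complement, and where `E` lists all
deterministic machines up to equivalence (`OracleTM.exists_enumeration`). A free word (second letter
`0`) belongs to `O` if and only if it belongs to `X`. Every other word is read as the code of a
computation: with the flag `c` and `τ` the list of the outputs of the single steps, it belongs to `O`
if and only if machine `i` halts on input `x` with trace `τ` relative to `O` and, moreover, all outputs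
of computations of machine `i` of length `|τ|` lie in the set `A c`. All this depends on shorter words
only, since a computation of `T` steps cannot ask a query of length `T`, and since membership of a word
in `K^O` depends on shorter words of `O` (`canonicalK_congr`).

*Optimal proof systems.* The function `proofSystem` reads a word, asks `O` whether it is the code of a
computation with flag `c`, and returns the output of this computation, or a fixed element of the set if
the answer is negative. By the soundness condition all its values lie in the set. If `f` is a proof
system for the set, computed by machine `i`, then the soundness condition holds at all lengths, and
`f x` is the value at the code of the computation of machine `i` on input `x`; this code is written in
polynomial time by a machine that simulates machine `i` and logs its outputs (`traceMachine`).
Constant functions show that every element of the set is a value.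

*`P ≠ NP`.* The set `witnessLang O` of all `x` such that `y₁x₁y₂x₂… ∈ O` for some `y` belongs to
`NP^O`. Up to length `q`, the oracle `O` is determined by `X` and by the `2q²` bits that say which
machines are sound at which lengths. Once these bits are given, whether `v ∈ O` is determined by a
decision tree of depth `|v|` over `X` (`decTree_mem_codingOracle`): the cost of a computation is bounded
by its number of steps, as writing a query takes as many steps as the query has letters. Hence a
deterministic machine with running time `q` decides membership of `R` words `x` by a decision tree of
depth `Rq`. If it is random whether these words have a witness in `X`, and the witnesses themselves are
random, such a tree gives `R` correct answers with exponentially small probability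
(`DecTree.card_le`). For `R = 6q²` this outweighs the number of possible advice strings, so some choice
of `X` makes the machine fail, whatever the correct advice is (`exists_extension_lang_ne`). A finite
extension argument treats all machines (`exists_oracle_forall`).
-/

namespace OracleComplexity

open Turing

namespace OracleTM

/-! ### Computation paths and their traces -/

theorem next_halt {M : OracleTM} {c : M.Cfg} {b : Bool} (h : M.role c.state = .halt b)
    (D : Oracle) : M.next D c = ∅ := by
  simp [next, h]

open Classical in
theorem next_query {M : OracleTM} {c : M.Cfg} {yes no : M.State}
    (h : M.role c.state = .query yes no) (D : Oracle) :
    M.next D c = {{ c with state := if c.query ∈ D then yes else no, query := [] }} := by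
  simp [next, h]

theorem next_act {M : OracleTM} {c : M.Cfg}
    {δ : (Fin (M.k + 1) → TapeSymbol M.Aux) → Set (Action M.k M.State M.Aux)}
    (h : M.role c.state = .act δ) (D : Oracle) :
    M.next D c = c.apply '' δ (fun j => (c.tape j).head) := by
  simp [next, h]

theorem exists_output_of_mem_next {M : OracleTM} {D : Oracle} {c d : M.Cfg}
    (h : d ∈ M.next D c) : ∃ o : Option Bool, d.output = c.output ++ o.toList := by
  cases hr : M.role c.state with
  | halt b => simp [next_halt hr] at h
  | query yes no =>
    rw [next_query hr, Set.mem_singleton_iff] at h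
    exact ⟨none, by simp [h]⟩
  | act δ =>
    rw [next_act hr] at h
    obtain ⟨a, -, rfl⟩ := h
    exact ⟨a.output, rfl⟩

theorem query_length_of_mem_next {M : OracleTM} {D : Oracle} {c d : M.Cfg}
    (h : d ∈ M.next D c) : d.query.length ≤ c.query.length + 1 := by
  cases hr : M.role c.state with
  | halt b => simp [next_halt hr] at h
  | query yes no =>
    rw [next_query hr, Set.mem_singleton_iff] at h
    simp [h]
  | act δ =>
    rw [next_act hr] at h
    obtain ⟨a, -, rfl⟩ := h
    cases ha : a.query <;> simp [Cfg.apply, ha]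

theorem next_congr {M : OracleTM} {D D' : Oracle} {c : M.Cfg} (h : c.query ∈ D ↔ c.query ∈ D') :
    M.next D c = M.next D' c := by
  cases hr : M.role c.state with
  | halt b => simp [next_halt hr]
  | query yes no =>
    rw [next_query hr, next_query hr]
    by_cases hq : c.query ∈ D
    · simp [hq, h.1 hq]
    · simp [hq, mt h.2 hq]
  | act δ => simp [next_act hr]

theorem Deterministic.subsingleton_next {M : OracleTM} (hM : M.Deterministic) (D : Oracle)
    (c : M.Cfg) : (M.next D c).Subsingleton := by
  cases hr : M.role c.state with
  | halt b => simp [next_halt hr]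
  | query yes no => simp [next_query hr]
  | act δ => rw [next_act hr]; exact (hM _ _ hr _).image _

/-- `M.Run D τ c c'`: some computation path relative to `D` leads from `c` to `c'` with trace `τ`,
the list of what the successive steps append to the output (`none` for a step without output).
In particular the path has `τ.length` steps. -/
def Run (M : OracleTM) (D : Oracle) : List (Option Bool) → M.Cfg → M.Cfg → Prop
  | [], c, c' => c = c'
  | o :: τ, c, c' => ∃ d ∈ M.next D c, d.output = c.output ++ o.toList ∧ M.Run D τ d c'

theorem reaches_iff_exists_run {M : OracleTM} {D : Oracle} {n : ℕ} {c c' : M.Cfg} :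
    M.Reaches D n c c' ↔ ∃ τ, τ.length = n ∧ M.Run D τ c c' := by
  induction n generalizing c with
  | zero =>
    constructor
    · intro h; exact ⟨[], rfl, h⟩
    · rintro ⟨τ, h, hτ⟩
      rw [List.length_eq_zero_iff] at h
      subst h; exact hτ
  | succ n ih =>
    constructor
    · rintro ⟨d, hd, h⟩
      obtain ⟨τ, hl, hτ⟩ := ih.1 h
      obtain ⟨o, ho⟩ := exists_output_of_mem_next hd
      exact ⟨o :: τ, by simp [hl], d, hd, ho, hτ⟩
    · rintro ⟨_ | ⟨o, τ⟩, hl, hτ⟩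
      · simp at hl
      · obtain ⟨d, hd, -, h⟩ := hτ
        exact ⟨d, hd, ih.2 ⟨τ, by simpa using hl, h⟩⟩

theorem Run.output_eq {M : OracleTM} {D : Oracle} {τ : List (Option Bool)} {c c' : M.Cfg}
    (h : M.Run D τ c c') : c'.output = c.output ++ τ.reduceOption := by
  induction τ generalizing c with
  | nil => cases h; simp
  | cons o τ ih =>
    obtain ⟨d, -, ho, h⟩ := h
    rw [ih h, ho]
    cases o <;> simp

/-- A path of `τ.length` steps only asks queries that are shorter than the sum of `τ.length` and
of the length of what is already on the query tape. -/
theorem Run.congr {M : OracleTM} {D D' : Oracle} {τ : List (Option Bool)} {c c' : M.Cfg}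
    (h : M.Run D τ c c')
    (hD : ∀ u : Word, u.length < c.query.length + τ.length → (u ∈ D ↔ u ∈ D')) :
    M.Run D' τ c c' := by
  induction τ generalizing c with
  | nil => exact h
  | cons o τ ih =>
    obtain ⟨d, hd, ho, h⟩ := h
    have hq := query_length_of_mem_next hd
    refine ⟨d, ?_, ho, ih h fun u hu => hD u ?_⟩
    · rwa [← next_congr (hD c.query (by simp))]
    · simp only [List.length_cons]; omega

theorem Run.trans {M : OracleTM} {D : Oracle} {τ σ : List (Option Bool)} {c c' c'' : M.Cfg}
    (h : M.Run D τ c c') (h' : M.Run D σ c' c'') : M.Run D (τ ++ σ) c c'' := by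
  induction τ generalizing c with
  | nil => cases h; exact h'
  | cons o τ ih =>
    obtain ⟨d, hd, ho, h⟩ := h
    exact ⟨d, hd, ho, ih h⟩

/-- In a deterministic machine, a path that cannot be continued extends every other path. -/
theorem Deterministic.run_append {M : OracleTM} (hM : M.Deterministic) {D : Oracle}
    {τ σ : List (Option Bool)} {c c' c'' : M.Cfg} (h : M.Run D τ c c') (hc : M.next D c' = ∅)
    (h' : M.Run D σ c c'') : ∃ ρ, τ = σ ++ ρ ∧ M.Run D ρ c'' c' := by
  induction σ generalizing c τ with
  | nil => cases h'; exact ⟨τ, rfl, h⟩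
  | cons o σ ih =>
    obtain ⟨d, hd, ho, h'⟩ := h'
    cases τ with
    | nil => cases h; simp [hc] at hd
    | cons o₁ τ =>
      obtain ⟨d₁, hd₁, ho₁, h⟩ := h
      obtain rfl := hM.subsingleton_next D c hd hd₁
      obtain ⟨ρ, rfl, hρ⟩ := ih h h'
      rw [ho, List.append_cancel_left_eq] at ho₁
      refine ⟨ρ, ?_, hρ⟩
      cases o <;> cases o₁ <;> simp_all

/-- `M.HaltsWith D x τ b`: some path of `M^D(x)` halts with trace `τ`, and it accepts if and only
if `b = true`. -/
def HaltsWith (M : OracleTM) (D : Oracle) (x : Word) (τ : List (Option Bool)) (b : Bool) : Prop :=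
  ∃ c, M.Run D τ (M.init x) c ∧ M.role c.state = .halt b

theorem acceptsWithin_iff {M : OracleTM} {D : Oracle} {x : Word} {t : ℕ} :
    M.AcceptsWithin D x t ↔ ∃ τ, τ.length ≤ t ∧ M.HaltsWith D x τ true := by
  simp only [AcceptsWithin, reaches_iff_exists_run, HaltsWith]
  constructor
  · rintro ⟨m, hm, c, ⟨τ, rfl, h⟩, hr⟩; exact ⟨τ, hm, c, h, hr⟩
  · rintro ⟨τ, hm, c, h, hr⟩; exact ⟨_, hm, c, ⟨τ, rfl, h⟩, hr⟩

theorem stopsWithin_iff {M : OracleTM} {D : Oracle} {x : Word} {n : ℕ} :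
    M.StopsWithin D x n ↔ ∀ τ c, M.Run D τ (M.init x) c → τ.length ≤ n := by
  simp only [StopsWithin, reaches_iff_exists_run]
  constructor
  · intro h τ c hτ; exact h _ c ⟨τ, rfl, hτ⟩
  · rintro h m c ⟨τ, rfl, hτ⟩; exact h τ c hτ

theorem mem_lang_iff {M : OracleTM} {D : Oracle} {x : Word} :
    x ∈ M.lang D ↔ ∃ τ, M.HaltsWith D x τ true := by
  simp only [lang, Set.mem_ofPred_eq, acceptsWithin_iff]
  exact ⟨fun ⟨_, τ, _, h⟩ => ⟨τ, h⟩, fun ⟨τ, h⟩ => ⟨_, τ, le_rfl, h⟩⟩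

theorem HaltsWith.congr {M : OracleTM} {D D' : Oracle} {x : Word} {τ : List (Option Bool)}
    {b : Bool} (h : M.HaltsWith D x τ b)
    (hD : ∀ u : Word, u.length < τ.length → (u ∈ D ↔ u ∈ D')) : M.HaltsWith D' x τ b := by
  obtain ⟨c, hc, hr⟩ := h
  exact ⟨c, hc.congr (by simpa [init] using hD), hr⟩

theorem AcceptsWithin.congr {M : OracleTM} {D D' : Oracle} {x : Word} {t : ℕ}
    (h : M.AcceptsWithin D x t) (hD : ∀ u : Word, u.length < t → (u ∈ D ↔ u ∈ D')) :
    M.AcceptsWithin D' x t := by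
  rw [acceptsWithin_iff] at h ⊢
  obtain ⟨τ, hτ, h⟩ := h
  exact ⟨τ, hτ, h.congr fun u hu => hD u (hu.trans_le hτ)⟩

theorem Deterministic.haltsWith_unique {M : OracleTM} (hM : M.Deterministic) {D : Oracle}
    {x : Word} {τ σ : List (Option Bool)} {b b' : Bool} (h : M.HaltsWith D x τ b)
    (h' : M.HaltsWith D x σ b') : τ = σ ∧ b = b' := by
  obtain ⟨c, hc, hr⟩ := h
  obtain ⟨c', hc', hr'⟩ := h'
  obtain ⟨ρ, rfl, hρ⟩ := hM.run_append hc (next_halt hr D) hc'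
  cases ρ with
  | nil => cases hρ; simp_all
  | cons o ρ => obtain ⟨d, hd, -⟩ := hρ; simp [next_halt hr'] at hd

theorem Deterministic.stopsWithin {M : OracleTM} (hM : M.Deterministic) {D : Oracle}
    {x : Word} {τ : List (Option Bool)} {c : M.Cfg} (h : M.Run D τ (M.init x) c)
    (hc : M.next D c = ∅) {n : ℕ} (hn : τ.length ≤ n) : M.StopsWithin D x n := by
  rw [stopsWithin_iff]
  intro σ c' hσ
  obtain ⟨ρ, rfl, -⟩ := hM.run_append h hc hσ
  simp at hn
  omega

theorem computes_iff {M : OracleTM} {D : Oracle} {f : Word → Word} :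
    M.Computes D f ↔ ∀ x, ∃ τ b, M.HaltsWith D x τ b ∧ τ.reduceOption = f x := by
  have key : ∀ (x : Word) (τ : List (Option Bool)) (c : M.Cfg), M.Run D τ (M.init x) c →
      c.output = τ.reduceOption := fun x τ c h => by simpa [init] using h.output_eq
  simp only [Computes, reaches_iff_exists_run, HaltsWith]
  refine forall_congr' fun x => ⟨?_, ?_⟩
  · rintro ⟨_, c, b, ⟨τ, rfl, h⟩, hr, ho⟩
    exact ⟨τ, b, ⟨c, h, hr⟩, by rw [← key x τ c h, ho]⟩
  · rintro ⟨τ, b, ⟨c, h, hr⟩, ho⟩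
    exact ⟨_, c, b, ⟨τ, rfl, h⟩, hr, by rw [key x τ c h, ho]⟩

/-- A machine that stops within `n` steps has, on each input, a path that cannot be continued. -/
theorem StopsWithin.exists_stuck {M : OracleTM} {D : Oracle} {x : Word} {n : ℕ}
    (h : M.StopsWithin D x n) :
    ∃ τ c, M.Run D τ (M.init x) c ∧ M.next D c = ∅ ∧ τ.length ≤ n := by
  rw [stopsWithin_iff] at h
  by_contra! hne
  have : ∀ m, ∃ τ c, M.Run D τ (M.init x) c ∧ τ.length = m := by
    intro m
    induction m with
    | zero => exact ⟨[], _, rfl, rfl⟩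
    | succ m ih =>
      obtain ⟨τ, c, hc, rfl⟩ := ih
      have : (M.next D c).Nonempty := by
        rw [Set.nonempty_iff_ne_empty]
        intro h0
        exact absurd (hne τ c hc h0) (not_lt.2 (h τ c hc))
      obtain ⟨d, hd⟩ := this
      obtain ⟨o, ho⟩ := exists_output_of_mem_next hd
      exact ⟨τ ++ [o], d, hc.trans ⟨d, hd, ho, rfl⟩, by simp⟩
  obtain ⟨τ, c, hc, hl⟩ := this (n + 1)
  have := h τ c hc
  omega

/-! ### Renaming states and symbols -/

/-- Two machines that have the same halting traces and the same time bounds. -/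
def Equivalent (M N : OracleTM) : Prop :=
  (∀ D x τ b, M.HaltsWith D x τ b ↔ N.HaltsWith D x τ b) ∧
    ∀ D x n, M.StopsWithin D x n ↔ N.StopsWithin D x n

theorem equivalent_of_map {M N : OracleTM} (φ : M.Cfg → N.Cfg)
    (hinit : ∀ x, φ (M.init x) = N.init x)
    (hnext : ∀ D c, N.next D (φ c) = φ '' M.next D c)
    (hrole : ∀ c b, N.role (φ c).state = .halt b ↔ M.role c.state = .halt b)
    (hout : ∀ c, (φ c).output = c.output) : M.Equivalent N := by
  have fwd : ∀ D τ c c', M.Run D τ c c' → N.Run D τ (φ c) (φ c') := by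
    intro D τ
    induction τ with
    | nil => rintro c c' rfl; rfl
    | cons o τ ih =>
      rintro c c' ⟨d, hd, ho, h⟩
      exact ⟨φ d, by rw [hnext]; exact ⟨d, hd, rfl⟩, by rw [hout, hout, ho], ih _ _ h⟩
  have bwd : ∀ D τ c c', N.Run D τ (φ c) c' → ∃ d, φ d = c' ∧ M.Run D τ c d := by
    intro D τ
    induction τ with
    | nil => rintro c c' rfl; exact ⟨c, rfl, rfl⟩
    | cons o τ ih =>
      rintro c c' ⟨d, hd, ho, h⟩
      rw [hnext] at hd
      obtain ⟨d, hd, rfl⟩ := hd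
      rw [hout, hout] at ho
      obtain ⟨e, he, h⟩ := ih _ _ h
      exact ⟨e, he, d, hd, ho, h⟩
  refine ⟨fun D x τ b => ⟨?_, ?_⟩, fun D x n => ?_⟩
  · rintro ⟨c, hc, hr⟩
    exact ⟨φ c, by rw [← hinit]; exact fwd _ _ _ _ hc, (hrole _ _).2 hr⟩
  · rintro ⟨c, hc, hr⟩
    rw [← hinit] at hc
    obtain ⟨d, rfl, hd⟩ := bwd _ _ _ _ hc
    exact ⟨d, hd, (hrole _ _).1 hr⟩
  · rw [stopsWithin_iff, stopsWithin_iff]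
    constructor
    · intro h τ c hc
      rw [← hinit] at hc
      obtain ⟨d, rfl, hd⟩ := bwd _ _ _ _ hc
      exact h τ d hd
    · intro h τ c hc
      exact h τ (φ c) (by rw [← hinit]; exact fwd _ _ _ _ hc)

end OracleTM

theorem finite_action (k : ℕ) (Q Γ : Type) [Finite Q] [Finite Γ] : Finite (Action k Q Γ) :=
  have : Finite Turing.Dir := Finite.of_injective (fun d => d = Turing.Dir.left) <| by
    rintro (_ | _) (_ | _) h <;> simp_all
  Finite.of_injective (fun a => (a.next, a.write, a.move, a.query, a.output) :
      Action k Q Γ → Q × (Fin (k + 1) → TapeSymbol Γ) × (Fin (k + 1) → Option Turing.Dir) ×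
        Option Bool × Option Bool) <| by
    rintro ⟨⟩ ⟨⟩ h
    simpa using h

theorem finite_role (k : ℕ) (Q Γ : Type) [Finite Q] [Finite Γ] : Finite (Role k Q Γ) := by
  have := finite_action k Q Γ
  refine Finite.of_injective (fun r => match r with
    | .halt b => Sum.inl b
    | .query y n => Sum.inr (Sum.inl (y, n))
    | .act δ => Sum.inr (Sum.inr δ) :
      Role k Q Γ → Bool ⊕ (Q × Q) ⊕ ((Fin (k + 1) → TapeSymbol Γ) → Set (Action k Q Γ))) ?_
  rintro (_ | _ | _) (_ | _ | _) h <;> simp_all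

/-- Renaming the states and symbols of an action. -/
def Action.map {k : ℕ} {Q Γ Q' Γ' : Type} (e : Q → Q') (f : TapeSymbol Γ → TapeSymbol Γ')
    (a : Action k Q Γ) : Action k Q' Γ' where
  next := e a.next
  write := fun j => f (a.write j)
  move := a.move
  query := a.query
  output := a.output

/-- Renaming the states and symbols of a role; `g` translates symbols back. -/
def Role.map {k : ℕ} {Q Γ Q' Γ' : Type} (e : Q → Q') (f : TapeSymbol Γ → TapeSymbol Γ')
    (g : TapeSymbol Γ' → TapeSymbol Γ) : Role k Q Γ → Role k Q' Γ'
  | .halt b => .halt b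
  | .query y n => .query (e y) (e n)
  | .act δ => .act fun s => Action.map e f '' δ fun j => g (s j)

namespace OracleTM

/-- The machine `M` with its states and auxiliary symbols renamed. -/
abbrev rename (M : OracleTM) {Q Γ : Type} [Finite Q] [Finite Γ] (e : M.State ≃ Q)
    (e' : M.Aux ≃ Γ) : OracleTM where
  k := M.k
  State := Q
  Aux := Γ
  finite_state := inferInstance
  finite_aux := inferInstance
  start := e M.start
  role := fun q => (M.role (e.symm q)).map e (Option.map (Sum.map id e'))
    (Option.map (Sum.map id e'.symm))

theorem Deterministic.rename {M : OracleTM} (hM : M.Deterministic) {Q Γ : Type} [Finite Q]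
    [Finite Γ] (e : M.State ≃ Q) (e' : M.Aux ≃ Γ) : (M.rename e e').Deterministic := by
  intro q δ hq s
  cases hr : M.role (e.symm q) with
  | halt b => simp [hr, Role.map] at hq
  | query y n => simp [hr, Role.map] at hq
  | act δ' =>
    simp only [hr, Role.map] at hq
    cases hq
    exact (hM _ _ hr _).image _

theorem equivalent_rename (M : OracleTM) {Q Γ : Type} [Finite Q] [Finite Γ] (e : M.State ≃ Q)
    (e' : M.Aux ≃ Γ) : M.Equivalent (M.rename e e') := by
  let F : PointedMap (TapeSymbol M.Aux) (TapeSymbol Γ) := ⟨Option.map (Sum.map id e'), rfl⟩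
  have hF : ∀ s, Option.map (Sum.map id e'.symm) (F s) = s := by
    rintro (_ | _ | _) <;> simp [F]
  refine equivalent_of_map (fun c => ⟨e c.state, fun j => (c.tape j).map F, c.query, c.output⟩)
    ?_ ?_ ?_ fun _ => rfl
  · intro x
    have h1 : ∀ j : Fin (M.k + 1), ((M.init x).tape j).map F =
        ((M.rename e e').init x).tape j := by
      intro j
      by_cases hj : j = 0
      · subst hj
        simp only [init, if_true, Tape.map_mk₁, List.map_map]
        rfl
      · simp [init, if_neg hj, Tape.map_mk₁]
    simp only [h1]
    simp [init]
  · intro D c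
    cases hr : M.role c.state with
    | halt b =>
      rw [next_halt hr, next_halt (b := b) (by simp [hr, Role.map])]
      simp
    | query y n =>
      rw [next_query hr, next_query (yes := e y) (no := e n) (by simp [hr, Role.map]),
        Set.image_singleton]
      simp only [Set.singleton_eq_singleton_iff, Cfg.mk.injEq, and_true]
      split_ifs <;> rfl
    | act δ =>
      rw [next_act hr, next_act (by simp only [Equiv.symm_apply_apply, hr, Role.map]; rfl)]
      have hhead : ∀ j, Option.map (Sum.map id e'.symm) ((c.tape j).map F).head =
          (c.tape j).head := fun j => by rw [Tape.map_fst, hF]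
      simp only [hhead, Set.image_image]
      refine Set.image_congr fun b _ => ?_
      simp only [Cfg.apply, Action.map, Cfg.mk.injEq, true_and, and_true]
      funext j
      have hw : ((c.tape j).write (b.write j)).map F = ((c.tape j).map F).write (F (b.write j)) :=
        Tape.map_write ..
      rcases b.move j with _ | dir
      · exact hw.symm
      · exact (congrArg (Tape.move dir) hw).symm.trans (Tape.map_move F _ dir).symm
  · intro c b
    simp only [Equiv.symm_apply_apply]
    cases M.role c.state <;> simp [Role.map]

/-- The data of an oracle machine whose states and auxiliary symbols are initial segments of `ℕ`. -/
abbrev FinData : Type :=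
  Σ k : ℕ, Σ m : ℕ, Σ a : ℕ, Fin m × (Fin m → Role k (Fin m) (Fin a))

/-- The machine described by an element of `FinData`. -/
def ofFinData (d : FinData) : OracleTM where
  k := d.1
  State := Fin d.2.1
  Aux := Fin d.2.2.1
  finite_state := inferInstance
  finite_aux := inferInstance
  start := d.2.2.2.1
  role := d.2.2.2.2

instance : Countable FinData := by
  have := finite_role
  infer_instance

theorem exists_finData (M : OracleTM) (hM : M.Deterministic) :
    ∃ d, (ofFinData d).Deterministic ∧ M.Equivalent (ofFinData d) := by
  have := M.finite_state
  have := M.finite_aux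
  obtain ⟨m, ⟨e⟩⟩ := Finite.exists_equiv_fin M.State
  obtain ⟨a, ⟨e'⟩⟩ := Finite.exists_equiv_fin M.Aux
  exact ⟨⟨M.k, m, a, (M.rename e e').start, (M.rename e e').role⟩, hM.rename e e',
    M.equivalent_rename e e'⟩

/-- Up to equivalence there are only countably many deterministic machines. -/
theorem exists_enumeration : ∃ E : ℕ → OracleTM, (∀ i, (E i).Deterministic) ∧
    ∀ M : OracleTM, M.Deterministic → ∃ i, M.Equivalent (E i) := by
  let T : OracleTM :=
    { k := 0, State := Unit, Aux := Unit, finite_state := inferInstance,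
      finite_aux := inferInstance, start := (), role := fun _ => .halt true }
  have hT : T.Deterministic := fun q δ h => by cases h
  obtain ⟨d, hd, -⟩ := exists_finData T hT
  have : Nonempty {d // (ofFinData d).Deterministic} := ⟨⟨d, hd⟩⟩
  obtain ⟨E, hE⟩ := exists_surjective_nat {d // (ofFinData d).Deterministic}
  refine ⟨fun i => ofFinData (E i), fun i => (E i).2, fun M hM => ?_⟩
  obtain ⟨d, hd, h⟩ := exists_finData M hM
  obtain ⟨i, hi⟩ := hE ⟨d, hd⟩
  exact ⟨i, by simpa [hi] using h⟩

end OracleTM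

/-! ### Decision trees -/

open Classical in
/-- `DecTree d F`: the value `F X` is determined by a decision tree of depth at most `d` whose
nodes ask whether a word belongs to `X`. -/
inductive DecTree {β : Type} : ℕ → (Oracle → β) → Prop
  | const (d : ℕ) (b : β) : DecTree d fun _ => b
  | query (d : ℕ) (v : Word) (F G : Oracle → β) : DecTree d F → DecTree d G →
      DecTree (d + 1) fun X => if v ∈ X then F X else G X

namespace DecTree

variable {β γ ε : Type}

theorem mono {d e : ℕ} {F : Oracle → β} (h : DecTree d F) (hde : d ≤ e) : DecTree e F := by
  induction h generalizing e with
  | const d b => exact .const _ _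
  | query d v F G _ _ ihF ihG =>
    obtain ⟨e, rfl⟩ : ∃ e', e = e' + 1 := ⟨e - 1, by omega⟩
    exact .query _ _ _ _ (ihF (by omega)) (ihG (by omega))

theorem map {d : ℕ} {F : Oracle → β} (h : DecTree d F) (k : β → γ) :
    DecTree d fun X => k (F X) := by
  induction h with
  | const d b => exact .const _ _
  | query d v F G _ _ ihF ihG =>
    convert DecTree.query d v _ _ ihF ihG using 2 with X
    beta_reduce
    split_ifs <;> rfl

theorem bind {d e : ℕ} {F : Oracle → β} (h : DecTree d F) {G : β → Oracle → γ}
    (hG : ∀ b, DecTree e (G b)) : DecTree (d + e) fun X => G (F X) X := by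
  induction h with
  | const d b => exact (hG b).mono (by omega)
  | query d v F G' _ _ ihF ihG =>
    rw [add_right_comm]
    convert DecTree.query (d + e) v _ _ ihF ihG using 2 with X
    beta_reduce
    split_ifs <;> rfl

theorem mem (v : Word) : DecTree 1 fun X => v ∈ X := by
  convert DecTree.query 0 v _ _ (.const 0 True) (.const 0 False) using 2 with X
  simp

theorem pi {n d : ℕ} {F : Fin n → Oracle → β} (h : ∀ i, DecTree d (F i)) :
    DecTree (n * d) fun X i => F i X := by
  induction n with
  | zero => convert DecTree.const (0 * d) (Fin.elim0 : Fin 0 → β)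
  | succ n ih =>
    have h1 := (h 0).bind (G := fun b X => (Fin.cons b fun i => F (Fin.succ i) X : Fin (n + 1) → β))
      fun b => (ih fun i => h i.succ).map fun t => (Fin.cons b t : Fin (n + 1) → β)
    convert h1 using 1
    · ring
    · funext X i
      cases i using Fin.cases <;> rfl

/-! ### Shallow decision trees do not guess random bits -/

open Classical in
/-- The oracle `Xs s` hides the bits `(s i).1`: the bit at `i` is visible only to someone who
queries the word belonging to `i` and to the key `(s i).2`. A decision tree of depth `d` either finds
the key, which leaves at most `d` possibilities for it, or learns nothing about the bit. Here `A`
is the set of those `i` for which `s i` is not yet known. -/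
theorem card_le {ι Y : Type} [Fintype ι] [Fintype Y] {Xs : (ι → Bool × Y) → Oracle}
    (hXs : ∀ v, (∃ p : Prop, ∀ s, v ∈ Xs s ↔ p) ∨ ∃ i y, ∀ s, v ∈ Xs s ↔ s i = (true, y))
    {d : ℕ} {F : Oracle → ι → Bool} (hF : DecTree d F) (A : Finset ι) (s₀ : ι → Bool × Y) :
    (Finset.univ.filter fun s : ι → Bool × Y =>
      (∀ i ∉ A, s i = s₀ i) ∧ ∀ i, F (Xs s) i = (s i).1).card ≤ (d + Fintype.card Y) ^ A.card := by
  induction hF generalizing A s₀ with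
  | const d b =>
    calc _ ≤ (Fintype.piFinset fun i => if i ∈ A then (Finset.univ : Finset Y)
          else {(s₀ i).2}).card := by
            refine Finset.card_le_card_of_injOn (fun s i => (s i).2) ?_ ?_
            · intro s hs
              simp only [Finset.coe_filter, Finset.mem_univ, true_and, Set.mem_ofPred_eq] at hs
              simp only [Finset.mem_coe, Fintype.mem_piFinset]
              intro i
              split_ifs with hi
              · simp
              · simp [hs.1 i hi]
            · intro s hs t ht hst
              simp only [Finset.coe_filter, Finset.mem_univ, true_and, Set.mem_ofPred_eq] at hs ht
              funext i
              exact Prod.ext ((hs.2 i).symm.trans (ht.2 i)) (congrFun hst i)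
      _ = Fintype.card Y ^ A.card := by
            rw [Fintype.card_piFinset, ← Finset.prod_subset (Finset.subset_univ A)]
            · rw [Finset.prod_congr rfl (g := fun _ => Fintype.card Y)
                fun i hi => by simp [hi, Finset.card_univ]]
              simp
            · intro i _ hi; simp [hi]
      _ ≤ _ := Nat.pow_le_pow_left (by omega) _
  | query d v F G _ _ ihF ihG =>
    have hpow : ∀ a, (d + Fintype.card Y) ^ a ≤ (d + 1 + Fintype.card Y) ^ a := fun a =>
      Nat.pow_le_pow_left (by omega) _
    -- when the answer is the same for all remaining `s`, one of the two subtrees is irrelevant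
    have hyes (h : ∀ s : ι → Bool × Y, (∀ i ∉ A, s i = s₀ i) → v ∈ Xs s) :
        (Finset.univ.filter fun s : ι → Bool × Y => (∀ i ∉ A, s i = s₀ i) ∧
          ∀ i, (if v ∈ Xs s then F (Xs s) else G (Xs s)) i = (s i).1).card ≤
            (d + 1 + Fintype.card Y) ^ A.card := by
      refine ((Finset.card_le_card fun s hs => ?_).trans (ihF A s₀)).trans (hpow _)
      simp only [Finset.mem_filter, Finset.mem_univ, true_and] at hs ⊢
      exact ⟨hs.1, by simpa [h s hs.1] using hs.2⟩
    have hno (h : ∀ s : ι → Bool × Y, (∀ i ∉ A, s i = s₀ i) → v ∉ Xs s) :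
        (Finset.univ.filter fun s : ι → Bool × Y => (∀ i ∉ A, s i = s₀ i) ∧
          ∀ i, (if v ∈ Xs s then F (Xs s) else G (Xs s)) i = (s i).1).card ≤
            (d + 1 + Fintype.card Y) ^ A.card := by
      refine ((Finset.card_le_card fun s hs => ?_).trans (ihG A s₀)).trans (hpow _)
      simp only [Finset.mem_filter, Finset.mem_univ, true_and] at hs ⊢
      exact ⟨hs.1, by simpa [h s hs.1] using hs.2⟩
    rcases hXs v with ⟨p, hp⟩ | ⟨r, y, hr⟩
    · by_cases h : p
      · exact hyes fun s _ => (hp s).2 h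
      · exact hno fun s _ => mt (hp s).1 h
    · by_cases hrA : r ∈ A
      · have hsub : (Finset.univ.filter fun s : ι → Bool × Y => (∀ i ∉ A, s i = s₀ i) ∧
            ∀ i, (if v ∈ Xs s then F (Xs s) else G (Xs s)) i = (s i).1) ⊆
            (Finset.univ.filter fun s : ι → Bool × Y =>
              (∀ i ∉ A.erase r, s i = Function.update s₀ r (true, y) i) ∧
                ∀ i, F (Xs s) i = (s i).1) ∪
            (Finset.univ.filter fun s : ι → Bool × Y => (∀ i ∉ A, s i = s₀ i) ∧
              ∀ i, G (Xs s) i = (s i).1) := by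
          intro s hs
          simp only [Finset.mem_union, Finset.mem_filter, Finset.mem_univ, true_and] at hs ⊢
          by_cases hv : v ∈ Xs s
          · left
            refine ⟨fun i hi => ?_, by simpa [hv] using hs.2⟩
            by_cases hir : i = r
            · subst hir; simpa using (hr s).1 hv
            · rw [Function.update_of_ne hir]
              exact hs.1 i fun h => hi (Finset.mem_erase.2 ⟨hir, h⟩)
          · exact Or.inr ⟨hs.1, by simpa [hv] using hs.2⟩
        refine (Finset.card_le_card hsub).trans ((Finset.card_union_le _ _).trans ?_)
        refine (Nat.add_le_add (ihF (A.erase r) _) (ihG A s₀)).trans ?_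
        rw [← Finset.card_erase_add_one hrA, pow_succ, pow_succ]
        have := Nat.mul_le_mul (hpow (A.erase r).card)
          (le_refl (1 + (d + Fintype.card Y)))
        linarith
      · by_cases h : s₀ r = (true, y)
        · exact hyes fun s hs => (hr s).2 ((hs r hrA).trans h)
        · exact hno fun s hs hv => h ((hs r hrA).symm.trans ((hr s).1 hv))

/-- If there are not too many decision trees, then all of them fail for some `s`. -/
theorem exists_forall_ne {ι Y κ : Type} [Fintype ι] [Fintype Y] [Fintype κ]
    {Xs : (ι → Bool × Y) → Oracle}
    (hXs : ∀ v, (∃ p : Prop, ∀ s, v ∈ Xs s ↔ p) ∨ ∃ i y, ∀ s, v ∈ Xs s ↔ s i = (true, y))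
    {d : ℕ} {F : κ → Oracle → ι → Bool} (hF : ∀ α, DecTree d (F α))
    (hcard : Fintype.card κ * (d + Fintype.card Y) ^ Fintype.card ι <
      (2 * Fintype.card Y) ^ Fintype.card ι) :
    ∃ s : ι → Bool × Y, ∀ α, ∃ i, F α (Xs s) i ≠ (s i).1 := by
  classical
  by_contra! hne
  have hne' : ∀ s : ι → Bool × Y, ∃ α, ∀ i, F α (Xs s) i = (s i).1 := fun s => hne s
  have hcov : (Finset.univ : Finset (ι → Bool × Y)) ⊆ Finset.univ.biUnion fun α =>
      Finset.univ.filter fun s : ι → Bool × Y => ∀ i, F α (Xs s) i = (s i).1 := by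
    intro s _
    obtain ⟨α, hα⟩ := hne' s
    simp only [Finset.mem_biUnion, Finset.mem_filter, Finset.mem_univ, true_and]
    exact ⟨α, hα⟩
  have h1 := (Finset.card_le_card hcov).trans (Finset.card_biUnion_le_card_mul _ _
    ((d + Fintype.card Y) ^ Fintype.card ι) fun α _ => ?_)
  · simp [Finset.card_univ] at h1
    omega
  · by_cases hE : Nonempty (ι → Bool × Y)
    · simpa using card_le hXs (hF α) Finset.univ hE.some
    · rw [not_nonempty_iff] at hE
      simp

end DecTree

/-! ### Coding traces -/

/-- The code of one entry of a trace. -/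
def stepCode : Option Bool → Word
  | none => [false]
  | some b => [true, b]

/-- The header of a code, which holds the word `u`. -/
def headerCode (u : Word) : Word :=
  (u.flatMap fun b => [true, b]) ++ [false]

/-- The code of the claim that machine number `i` halts on input `x` with trace `τ`. -/
def traceCode (i : ℕ) (x : Word) (τ : List (Option Bool)) : Word :=
  headerCode (zeros i ++ true :: x) ++ τ.flatMap stepCode

/-- The output of the trace that is coded by a word. -/
def decodeSteps : Word → Word
  | [] => []
  | false :: w => decodeSteps w
  | [true] => []
  | true :: b :: w => b :: decodeSteps w

/-- The output of the computation that is coded by a word. -/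
def decode : Word → Word
  | [] => []
  | false :: w => decodeSteps w
  | [true] => []
  | true :: _ :: w => decode w

theorem decodeSteps_flatMap (τ : List (Option Bool)) :
    decodeSteps (τ.flatMap stepCode) = τ.reduceOption := by
  induction τ with
  | nil => rfl
  | cons o τ ih => cases o <;> simpa [stepCode, decodeSteps] using ih

theorem decode_traceCode (i : ℕ) (x : Word) (τ : List (Option Bool)) :
    decode (traceCode i x τ) = τ.reduceOption := by
  rw [traceCode, headerCode]
  induction zeros i ++ true :: x with
  | nil => simpa [decode] using decodeSteps_flatMap τ
  | cons b u ih => simpa [decode] using ih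

theorem flatMap_stepCode_injective :
    Function.Injective fun τ : List (Option Bool) => τ.flatMap stepCode := by
  intro τ σ h
  induction τ generalizing σ with
  | nil => rcases σ with _ | ⟨_ | _, σ⟩ <;> simp_all [stepCode]
  | cons o τ ih =>
    rcases o with _ | b <;> rcases σ with _ | ⟨_ | b', σ⟩ <;> simp [stepCode] at h ⊢
    · exact ih h
    · exact ⟨h.1, ih h.2⟩

theorem headerCode_append_inj {u u' v v' : Word} (h : headerCode u ++ v = headerCode u' ++ v') :
    u = u' ∧ v = v' := by
  induction u generalizing u' with
  | nil => cases u' <;> simp_all [headerCode]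
  | cons b u ih =>
    rcases u' with _ | ⟨b', u'⟩
    · simp [headerCode] at h
    · simp only [headerCode, List.flatMap_cons, List.cons_append, List.nil_append,
        List.cons.injEq, true_and] at h
      obtain ⟨rfl, rfl⟩ := ih (u' := u') h.2
      exact ⟨by rw [h.1], rfl⟩

theorem zeros_append_inj {i i' : ℕ} {x x' : Word}
    (h : zeros i ++ true :: x = zeros i' ++ true :: x') : i = i' ∧ x = x' := by
  induction i generalizing i' with
  | zero => cases i' <;> simp_all [zeros, List.replicate_succ]
  | succ i ih =>
    cases i' with
    | zero => simp [zeros, List.replicate_succ] at h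
    | succ i' => simpa using ih (i' := i') (by simpa [zeros, List.replicate_succ] using h)

theorem traceCode_inj {i i' : ℕ} {x x' : Word} {τ τ' : List (Option Bool)}
    (h : traceCode i x τ = traceCode i' x' τ') : i = i' ∧ x = x' ∧ τ = τ' := by
  obtain ⟨h1, h2⟩ := headerCode_append_inj h
  obtain ⟨h3, h4⟩ := zeros_append_inj h1
  exact ⟨h3, h4, flatMap_stepCode_injective h2⟩

theorem length_headerCode (u : Word) : (headerCode u).length = 2 * u.length + 1 := by
  induction u with
  | nil => rfl
  | cons b u ih => simp_all [headerCode]; omega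

theorem length_le_traceCode (i : ℕ) (x : Word) (τ : List (Option Bool)) :
    i + τ.length < (traceCode i x τ).length := by
  have : τ.length ≤ (τ.flatMap stepCode).length := by
    induction τ with
    | nil => simp
    | cons o τ ih => cases o <;> simp [stepCode] at ih ⊢ <;> omega
  simp only [traceCode, List.length_append, length_headerCode, zeros, List.length_replicate,
    List.length_cons]
  omega

/-! ### The oracle -/

/-- The words whose membership in the oracle is not used for coding. -/
def FreeWord (v : Word) : Prop := ∃ a w, v = a :: false :: w

/-- `v` codes, for one of the two values of the flag `c`, a halting computation relative to `D` of a
machine whose outputs are allowed by `adv`. -/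
def CodesComputation (E : ℕ → OracleTM) (adv : Bool → ℕ → ℕ → Prop) (D : Oracle) (v : Word) :
    Prop :=
  ∃ c i x τ b, v = c :: true :: traceCode i x τ ∧ adv c i τ.length ∧ (E i).HaltsWith D x τ b

/-- Membership in the oracle which agrees with `X` on free words and which, on the other words,
tells what they code relative to the oracle itself. The definition proceeds by recursion
on the length: whether `v` belongs to the oracle depends on shorter words only. -/
def InCodingOracle (E : ℕ → OracleTM) (adv : Oracle → Bool → ℕ → ℕ → Prop) (X : Oracle)
    (v : Word) : Prop :=
  (FreeWord v ∧ v ∈ X) ∨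
    CodesComputation E (adv {u | ∃ _ : u.length < v.length, InCodingOracle E adv X u})
      {u | ∃ _ : u.length < v.length, InCodingOracle E adv X u} v
termination_by v.length

/-- The oracle described at `InCodingOracle`. -/
def codingOracle (E : ℕ → OracleTM) (adv : Oracle → Bool → ℕ → ℕ → Prop) (X : Oracle) : Oracle :=
  {v | InCodingOracle E adv X v}

/-- The part of an oracle below a given length. -/
def below (D : Oracle) (n : ℕ) : Oracle := {u | u.length < n ∧ u ∈ D}

theorem mem_codingOracle {E : ℕ → OracleTM} {adv : Oracle → Bool → ℕ → ℕ → Prop} {X : Oracle}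
    {v : Word} : v ∈ codingOracle E adv X ↔ (FreeWord v ∧ v ∈ X) ∨
      CodesComputation E (adv (below (codingOracle E adv X) v.length))
        (below (codingOracle E adv X) v.length) v := by
  have : below (codingOracle E adv X) v.length =
      {u | ∃ _ : u.length < v.length, InCodingOracle E adv X u} := by
    ext u; simp [below, codingOracle]
  rw [this]
  change InCodingOracle E adv X v ↔ _
  rw [InCodingOracle]

theorem not_codesComputation {E : ℕ → OracleTM} {adv : Bool → ℕ → ℕ → Prop} {D : Oracle}
    {v : Word} (hv : FreeWord v) : ¬ CodesComputation E adv D v := by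
  rintro ⟨c, i, x, τ, b, rfl, -⟩
  obtain ⟨a, w, h⟩ := hv
  simp at h

theorem mem_codingOracle_of_freeWord {E : ℕ → OracleTM} {adv : Oracle → Bool → ℕ → ℕ → Prop}
    {X : Oracle} {v : Word} (hv : FreeWord v) : v ∈ codingOracle E adv X ↔ v ∈ X := by
  rw [mem_codingOracle]
  simp [hv, not_codesComputation hv]

/-- `E i` is sound for `A c` on computations of length `T`: all outputs belong to `A c D`. -/
def Sound (E : ℕ → OracleTM) (A : Bool → Oracle → Set Word) (D : Oracle) (c : Bool) (i T : ℕ) :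
    Prop :=
  ∀ x τ b, τ.length = T → (E i).HaltsWith D x τ b → τ.reduceOption ∈ A c D

/-- Membership of a word in `A c D` depends on shorter words of `D` only. -/
def Local (A : Bool → Oracle → Set Word) : Prop :=
  ∀ c D D' z, (∀ u : Word, u.length < z.length → (u ∈ D ↔ u ∈ D')) → z ∈ A c D → z ∈ A c D'

theorem Sound.congr {E : ℕ → OracleTM} {A : Bool → Oracle → Set Word} (hA : Local A)
    {D D' : Oracle} {c : Bool} {i T : ℕ} (h : Sound E A D c i T)
    (hD : ∀ u : Word, u.length < T → (u ∈ D ↔ u ∈ D')) : Sound E A D' c i T := by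
  intro x τ b hτ hx
  have hx' : (E i).HaltsWith D x τ b := hx.congr fun u hu => (hD u (hτ ▸ hu)).symm
  exact hA c D D' _ (fun u hu => hD u (by
    have := τ.reduceOption_length_le; omega)) (h x τ b hτ hx')

theorem mem_below {D : Oracle} {n : ℕ} {u : Word} (hu : u.length < n) :
    u ∈ below D n ↔ u ∈ D := by
  simp [below, hu]

theorem CodesComputation.congr {E : ℕ → OracleTM} {adv adv' : Bool → ℕ → ℕ → Prop}
    {D D' : Oracle} {v : Word} (h : CodesComputation E adv D v)
    (hadv : ∀ c i T, i < v.length → T < v.length → adv c i T → adv' c i T)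
    (hD : ∀ u : Word, u.length < v.length → (u ∈ D ↔ u ∈ D')) :
    CodesComputation E adv' D' v := by
  obtain ⟨c, i, x, τ, b, rfl, ha, hx⟩ := h
  have := length_le_traceCode i x τ
  simp only [List.length_cons] at hadv hD
  exact ⟨c, i, x, τ, b, rfl, hadv _ _ _ (by omega) (by omega) ha,
    hx.congr fun u hu => hD u (by omega)⟩

/-- Up to length `q`, the oracle can be computed from the advice on soundness for indices and
lengths below `q`. -/
theorem mem_codingOracle_sound_iff {E : ℕ → OracleTM} {A : Bool → Oracle → Set Word}
    (hA : Local A) {X X' : Oracle} {q : ℕ} (hX : ∀ u : Word, u.length ≤ q → (u ∈ X ↔ u ∈ X'))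
    {α : Bool → ℕ → ℕ → Prop} (hα : ∀ c i T, i < q → T < q →
      (α c i T ↔ Sound E A (codingOracle E (Sound E A) X) c i T)) (v : Word) (hv : v.length ≤ q) :
    v ∈ codingOracle E (Sound E A) X ↔ v ∈ codingOracle E (fun _ => α) X' := by
  induction hn : v.length using Nat.strong_induction_on generalizing v with
  | _ n ih =>
    subst hn
    have hD : ∀ u : Word, u.length < v.length →
        (u ∈ below (codingOracle E (Sound E A) X) v.length ↔
          u ∈ below (codingOracle E (fun _ => α) X') v.length) := fun u hu => by
      rw [mem_below hu, mem_below hu, ih u.length hu u (by omega) rfl]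
    rw [mem_codingOracle, mem_codingOracle, hX v hv]
    refine or_congr Iff.rfl ⟨fun h => h.congr ?_ hD,
      fun h => h.congr ?_ fun u hu => (hD u hu).symm⟩
    · intro c i T hi hT hs
      exact (hα c i T (by omega) (by omega)).2
        (hs.congr hA fun u hu => mem_below (hu.trans hT))
    · intro c i T hi hT hs
      exact ((hα c i T (by omega) (by omega)).1 hs).congr hA
        fun u hu => (mem_below (hu.trans hT)).symm

/-! ### Decision trees for computations -/

/-- The reachable configurations of a deterministic machine are determined by a decision tree whose
depth is at most the number of steps, if a query `v` costs at most `|v|`: appending the letters of `v`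
to the query tape takes that many steps. -/
theorem OracleTM.Deterministic.decTree_run {M : OracleTM} (hM : M.Deterministic)
    {O : Oracle → Oracle} (hO : ∀ v : Word, DecTree v.length fun X => v ∈ O X) (T : ℕ)
    (c : M.Cfg) : DecTree (c.query.length + T) fun X =>
      {p : List (Option Bool) × M.Cfg | p.1.length ≤ T ∧ M.Run (O X) p.1 c p.2} := by
  induction T generalizing c with
  | zero =>
    convert DecTree.const _ ({([], c)} : Set (List (Option Bool) × M.Cfg)) using 2 with X
    ext ⟨τ, d⟩
    simp only [nonpos_iff_eq_zero, List.length_eq_zero_iff, Set.mem_ofPred_eq,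
      Set.mem_singleton_iff, Prod.mk.injEq]
    constructor
    · rintro ⟨rfl, h⟩; exact ⟨rfl, h.symm⟩
    · rintro ⟨rfl, rfl⟩; exact ⟨rfl, rfl⟩
  | succ T ih =>
    let ext : Set M.Cfg → (M.Cfg → Set (List (Option Bool) × M.Cfg)) →
        Set (List (Option Bool) × M.Cfg) := fun N S =>
      {p | p = ([], c) ∨ ∃ o τ, p.1 = o :: τ ∧ ∃ d ∈ N, d.output = c.output ++ o.toList ∧
        (τ, p.2) ∈ S d}
    have hext : ∀ X, {p : List (Option Bool) × M.Cfg | p.1.length ≤ T + 1 ∧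
        M.Run (O X) p.1 c p.2} = ext (M.next (O X) c) fun d =>
          {p | p.1.length ≤ T ∧ M.Run (O X) p.1 d p.2} := by
      intro X
      refine Set.ext ?_; rintro ⟨τ, e⟩
      cases τ with
      | nil =>
        simp only [ext, OracleTM.Run, Set.mem_ofPred_eq, List.length_nil, Prod.mk.injEq]
        constructor
        · rintro ⟨-, rfl⟩; exact Or.inl ⟨trivial, rfl⟩
        · rintro (⟨-, rfl⟩ | ⟨o, τ, h, -⟩)
          · exact ⟨by omega, rfl⟩
          · cases h
      | cons o τ =>
        simp only [ext, OracleTM.Run, Set.mem_ofPred_eq, List.length_cons, Prod.mk.injEq]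
        constructor
        · rintro ⟨hl, d, hd, ho, h⟩
          exact Or.inr ⟨o, τ, rfl, d, hd, ho, by omega, h⟩
        · rintro (⟨h, -⟩ | ⟨o', τ', h, d, hd, ho, hl, hr⟩)
          · cases h
          · cases h; exact ⟨by omega, d, hd, ho, hr⟩
    have hsingle : ∀ d : M.Cfg, DecTree (d.query.length + T) fun X =>
        ext {d} fun d => {p | p.1.length ≤ T ∧ M.Run (O X) p.1 d p.2} := fun d => by
      convert (ih d).map fun S => ext {d} fun _ => S using 2 with X
      simp [ext]
    simp only [hext]
    cases hr : M.role c.state with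
    | halt b =>
      simp only [OracleTM.next_halt hr]
      convert DecTree.const _ (ext ∅ fun _ => ∅) using 2 with X
      simp [ext]
    | query yes no =>
      classical
      simp only [OracleTM.next_query hr]
      have h := (hO c.query).bind (e := T) (G := fun p X => ext {{ c with
        state := if p then yes else no, query := [] }}
          fun d => {p | p.1.length ≤ T ∧ M.Run (O X) p.1 d p.2}) fun p => by
        simpa using hsingle { c with state := if p then yes else no, query := [] }
      exact h.mono (by omega)
    | act δ =>
      simp only [OracleTM.next_act hr]
      rcases (hM _ _ hr fun j => (c.tape j).head).eq_empty_or_singleton with h | ⟨a, h⟩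
      · simp only [h, Set.image_empty]
        convert DecTree.const _ (ext ∅ fun _ => ∅) using 2 with X
        simp [ext]
      · simp only [h, Set.image_singleton]
        refine (hsingle _).mono ?_
        cases ha : a.query <;> simp [OracleTM.Cfg.apply, ha]
        omega

theorem OracleTM.Deterministic.decTree_haltsWith {M : OracleTM} (hM : M.Deterministic)
    {O : Oracle → Oracle} (hO : ∀ v : Word, DecTree v.length fun X => v ∈ O X) (T : ℕ)
    (x : Word) : DecTree T fun X =>
      {p : List (Option Bool) × Bool | p.1.length ≤ T ∧ M.HaltsWith (O X) x p.1 p.2} := by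
  convert (hM.decTree_run hO T (M.init x)).map (fun S => {p : List (Option Bool) × Bool |
    ∃ c, (p.1, c) ∈ S ∧ M.role c.state = .halt p.2}) using 2 with X
  · simp [OracleTM.init]
  · ext p
    simp only [OracleTM.HaltsWith, Set.mem_ofPred_eq]
    constructor
    · rintro ⟨h, c, hc, hr⟩; exact ⟨c, ⟨h, hc⟩, hr⟩
    · rintro ⟨c, ⟨h, hc⟩, hr⟩; exact ⟨h, c, hc, hr⟩

/-- With fixed advice, membership of `v` in the oracle is determined by a decision tree of depth `|v|`
over the free words. -/
theorem decTree_mem_codingOracle {E : ℕ → OracleTM} (hE : ∀ i, (E i).Deterministic)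
    (α : Bool → ℕ → ℕ → Prop) (v : Word) :
    DecTree v.length fun X => v ∈ codingOracle E (fun _ => α) X := by
  induction hn : v.length using Nat.strong_induction_on generalizing v with
  | _ n ih =>
    subst hn
    by_cases hv : FreeWord v
    · simp only [mem_codingOracle_of_freeWord hv]
      refine (DecTree.mem v).mono ?_
      obtain ⟨a, w, rfl⟩ := hv
      simp
    by_cases hc : ∃ c i x τ, v = c :: true :: traceCode i x τ
    · obtain ⟨c, i, x, τ, hcode⟩ := hc
      have hO : ∀ u : Word, DecTree u.length fun X =>
          u ∈ below (codingOracle E (fun _ => α) X) v.length := by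
        intro u
        by_cases hu : u.length < v.length
        · simpa only [mem_below hu] using ih u.length hu u rfl
        · simpa [below, hu] using DecTree.const u.length False
      have hlen := length_le_traceCode i x τ
      have key := (((hE i).decTree_haltsWith hO τ.length x).map fun S =>
        α c i τ.length ∧ ∃ b, (τ, b) ∈ S).mono (e := v.length) (by simp [hcode]; omega)
      convert key using 2 with X
      rw [mem_codingOracle]
      simp only [hv, false_and, false_or, Set.mem_ofPred_eq, le_refl, true_and, CodesComputation]
      constructor
      · rintro ⟨c', i', x', τ', b, h0, h1, h2⟩
        rw [hcode] at h0
        obtain ⟨rfl, h3⟩ := List.cons.inj h0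
        replace h3 := (List.cons.inj h3).2
        obtain ⟨rfl, rfl, rfl⟩ := traceCode_inj h3
        exact ⟨h1, b, h2⟩
      · rintro ⟨h1, b, h2⟩; exact ⟨c, i, x, τ, b, hcode, h1, h2⟩
    · convert DecTree.const v.length False using 2 with X
      rw [mem_codingOracle]
      simp only [hv, false_and, false_or, iff_false]
      rintro ⟨c, i, x, τ, b, h, -⟩
      exact hc ⟨c, i, x, τ, h⟩

/-! ### The language that separates `P` from `NP` -/

/-- The word `y₁x₁y₂x₂…`. -/
def interleave : Word → Word → Word
  | a :: y, b :: x => a :: b :: interleave y x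
  | _, _ => []

theorem length_interleave {y x : Word} (h : y.length = x.length) :
    (interleave y x).length = 2 * x.length := by
  induction x generalizing y with
  | nil => cases y <;> simp_all [interleave]
  | cons b x ih =>
    cases y with
    | nil => simp at h
    | cons a y => simp [interleave, ih (y := y) (by simpa using h)]; omega

theorem interleave_inj {y x y' x' : Word} (h : y.length = x.length) (h' : y'.length = x'.length)
    (he : interleave y x = interleave y' x') : y = y' ∧ x = x' := by
  induction x generalizing y y' x' with
  | nil =>
    have := congrArg List.length he
    rw [length_interleave h, length_interleave h'] at this
    simp only [List.length_nil, mul_zero] at this h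
    have h1 : x'.length = 0 := by omega
    rw [h1] at h'
    rw [List.length_eq_zero_iff] at h h' h1
    simp [h, h', h1]
  | cons b x ih =>
    rcases y with _ | ⟨a, y⟩
    · simp at h
    · rcases y' with _ | ⟨a', y'⟩ <;> rcases x' with _ | ⟨b', x'⟩ <;>
        simp [interleave] at he h h'
      obtain ⟨rfl, rfl⟩ := ih h h' he.2.2
      simp [he.1, he.2.1]

/-- The words `x` for which some interleaving of a word of the same length with `x` belongs to the
oracle. -/
def witnessLang (D : Oracle) : Set Word :=
  {x | ∃ y : Word, y.length = x.length ∧ interleave y x ∈ D}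

theorem exists_eval_le_two_pow (p : Polynomial ℕ) (N : ℕ) : ∃ n ≥ N, p.eval n ≤ 2 ^ n := by
  have key : (fun n : ℕ => ((p.eval n : ℕ) : ℝ)) =o[Filter.atTop] fun n : ℕ => (2 : ℝ) ^ n := by
    induction p using Polynomial.induction_on' with
    | add p q hp hq => simpa using hp.add hq
    | monomial k a =>
      simpa using (isLittleO_pow_const_const_pow_of_one_lt (R := ℝ) k one_lt_two).const_mul_left
        (a : ℝ)
  have h := (key.bound one_pos).and (Filter.eventually_ge_atTop N)
  obtain ⟨n, h1, h2⟩ := h.exists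
  refine ⟨n, h2, ?_⟩
  simp only [Real.norm_natCast, norm_pow, Real.norm_ofNat, one_mul] at h1
  exact_mod_cast h1

/-- The count behind `exists_extension_lang_ne`: `m` bits of advice, `3 * m` hidden bits, and trees
of depth `k`. It comes down to `2 * (3 / 4) ^ 3 < 1`. -/
theorem two_pow_mul_lt {m k Y : ℕ} (hm : 0 < m) (hk : 2 * k ≤ Y) (hY : 0 < Y) :
    2 ^ m * (k + Y) ^ (3 * m) < (2 * Y) ^ (3 * m) := by
  have h1 : (4 * (k + Y)) ^ (3 * m) ≤ (3 * (2 * Y)) ^ (3 * m) := Nat.pow_le_pow_left (by omega) _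
  rw [mul_pow, mul_pow] at h1
  have h2 : 2 ^ m * 3 ^ (3 * m) < 4 ^ (3 * m) := by
    rw [pow_mul, pow_mul, ← mul_pow]
    exact Nat.pow_lt_pow_left (by norm_num) hm.ne'
  have h3 : 0 < (2 * Y) ^ (3 * m) := by positivity
  have h4 : 0 < 4 ^ (3 * m) := by positivity
  nlinarith [Nat.mul_le_mul_left (2 ^ m) h1, Nat.mul_lt_mul_of_pos_right h2 h3]

open Classical in
/-- A deterministic polynomial-time machine can be prevented from deciding `witnessLang` by fixing a
finite part of the oracle. -/
theorem exists_extension_lang_ne {E : ℕ → OracleTM} (hE : ∀ i, (E i).Deterministic)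
    {A : Bool → Oracle → Set Word} (hA : Local A) {M : OracleTM} (hM : M.Deterministic)
    (hp : M.PolyTime) (N : ℕ) (X : Oracle) :
    ∃ N' ≥ N, ∃ X' : Oracle, (∀ u : Word, u.length < N → (u ∈ X' ↔ u ∈ X)) ∧
      ∀ Z : Oracle, (∀ u : Word, u.length < N' → (u ∈ Z ↔ u ∈ X')) →
        M.lang (codingOracle E (Sound E A) Z) ≠ witnessLang (codingOracle E (Sound E A) Z) := by
  obtain ⟨p, hp⟩ := hp
  -- the inequality says `2 * (3 * m) * q ≤ 2 ^ n` for the values of `m` and `q` below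
  obtain ⟨n, hnN, hn⟩ := exists_eval_le_two_pow (12 * (p + 1) ^ 3) (N + 1)
  obtain ⟨n, rfl⟩ : ∃ n', n = n' + 1 := ⟨n - 1, by omega⟩
  set q := p.eval (n + 1) + 1 with hq
  have hn : 12 * q ^ 3 ≤ 2 ^ (n + 1) := by simpa [hq] using hn
  have hqpos : 0 < q := by omega
  -- `m` bits of advice suffice for the oracle up to length `q`; `3 * m` inputs defeat all advice
  let m := 2 * (q * q)
  have hm : 0 < m := by positivity
  have hR : 3 * m ≤ 2 ^ n := by
    have : q * q ≤ q ^ 3 := by rw [pow_succ, pow_two]; exact Nat.le_mul_of_pos_right _ hqpos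
    have := pow_succ 2 n
    omega
  obtain ⟨e⟩ : Nonempty (Fin (3 * m) ↪ List.Vector Bool n) := by
    apply Function.Embedding.nonempty_of_card_le
    simpa using hR
  let x : Fin (3 * m) → Word := fun r => false :: (e r).1
  have hx : ∀ r, (x r).length = n + 1 := fun r => by simp [x, (e r).2]
  have hxinj : Function.Injective x := fun r r' h =>
    e.injective (Subtype.ext (List.cons.inj h).2)
  let Y := List.Vector Bool (n + 1)
  have hyx : ∀ (y : Y) r, y.1.length = (x r).length := fun y r => by rw [hx, y.2]
  have hlen : ∀ (y : Y) r, (interleave y.1 (x r)).length = 2 * (n + 1) := fun y r => by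
    rw [length_interleave (hyx y r), hx]
  -- `Xs s` extends the given finite part and contains the witness `(s r).2` for `x r` if `(s r).1`
  let Xs : (Fin (3 * m) → Bool × Y) → Oracle := fun s =>
    {u | (u ∈ X ∧ u.length < N) ∨ ∃ r, (s r).1 = true ∧ u = interleave (s r).2.1 (x r)}
  have hmem : ∀ s (y : Y) r, interleave y.1 (x r) ∈ Xs s ↔ s r = (true, y) := by
    intro s y r
    constructor
    · rintro (⟨-, h⟩ | ⟨r', h1, h2⟩)
      · rw [hlen] at h; omega
      · obtain ⟨h3, h4⟩ := interleave_inj (hyx y r) (hyx _ r') h2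
        obtain rfl := hxinj h4
        exact Prod.ext h1 (Subtype.ext h3.symm)
    · intro h
      exact Or.inr ⟨r, by rw [h], by rw [h]⟩
  have hXs : ∀ v, (∃ P : Prop, ∀ s, v ∈ Xs s ↔ P) ∨ ∃ r y, ∀ s, v ∈ Xs s ↔ s r = (true, y) := by
    intro v
    by_cases hv : ∃ r, ∃ y : Y, v = interleave y.1 (x r)
    · obtain ⟨r, y, rfl⟩ := hv
      exact Or.inr ⟨r, y, fun s => hmem s y r⟩
    · refine Or.inl ⟨v ∈ X ∧ v.length < N, fun s => ⟨?_, Or.inl⟩⟩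
      rintro (h | ⟨r, -, h⟩)
      · exact h
      · exact absurd ⟨r, _, h⟩ hv
  let adv : (Bool × Fin q × Fin q → Bool) → Bool → ℕ → ℕ → Prop := fun α c i T =>
    ∃ (hi : i < q) (hT : T < q), α (c, ⟨i, hi⟩, ⟨T, hT⟩) = true
  let F : (Bool × Fin q × Fin q → Bool) → Oracle → Fin (3 * m) → Bool := fun α X r =>
    decide (∃ τ, (τ, true) ∈ {p : List (Option Bool) × Bool | p.1.length ≤ q ∧
      M.HaltsWith (codingOracle E (fun _ => adv α) X) (x r) p.1 p.2})
  have hF : ∀ α, DecTree (3 * m * q) (F α) := fun α => DecTree.pi fun r =>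
    (hM.decTree_haltsWith (decTree_mem_codingOracle hE (adv α)) q (x r)).map
      fun S => decide (∃ τ, (τ, true) ∈ S)
  have hcard : Fintype.card (Bool × Fin q × Fin q → Bool) *
      (3 * m * q + Fintype.card Y) ^ Fintype.card (Fin (3 * m)) <
        (2 * Fintype.card Y) ^ Fintype.card (Fin (3 * m)) := by
    have h1 : Fintype.card Y = 2 ^ (n + 1) := by simp [Y]
    have h2 : Fintype.card (Bool × Fin q × Fin q → Bool) = 2 ^ m := by simp [m]
    rw [h1, h2, Fintype.card_fin]
    refine two_pow_mul_lt hm (le_trans (le_of_eq ?_) hn) (by positivity)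
    simp only [m]; ring
  obtain ⟨s, hs⟩ := DecTree.exists_forall_ne hXs hF hcard
  refine ⟨max N (max (2 * (n + 1) + 1) (q + 1)), le_max_left _ _, Xs s, ?_, ?_⟩
  · intro u hu
    refine ⟨?_, fun h => Or.inl ⟨h, hu⟩⟩
    rintro (h | ⟨r, -, rfl⟩)
    · exact h.1
    · rw [hlen] at hu; omega
  · intro Z hZ hlang
    set O := codingOracle E (Sound E A) Z with hO
    obtain ⟨r, hr⟩ := hs fun t => decide (Sound E A O t.1 t.2.1 t.2.2)
    -- the advice string that is correct for `O`
    set α : Bool × Fin q × Fin q → Bool := fun t => decide (Sound E A O t.1 t.2.1 t.2.2) with hα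
    have hOα : ∀ v : Word, v.length < q →
        (v ∈ O ↔ v ∈ codingOracle E (fun _ => adv α) (Xs s)) := by
      intro v hv
      refine mem_codingOracle_sound_iff (q := q) hA (fun u hu => hZ u (by omega)) ?_ v hv.le
      intro c i T hi hT
      simp [adv, hα, hi, hT, hO]
    have h1 : F α (Xs s) r = true ↔ x r ∈ M.lang O := by
      simp only [F, decide_eq_true_eq, Set.mem_ofPred_eq, OracleTM.mem_lang_iff]
      constructor
      · rintro ⟨τ, hτ, h⟩
        exact ⟨τ, h.congr fun u hu => (hOα u (by omega)).symm⟩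
      · rintro ⟨τ, h⟩
        obtain ⟨c, hc, -⟩ := id h
        have hτ := OracleTM.stopsWithin_iff.1 (hp O (x r)) τ c hc
        rw [hx] at hτ
        exact ⟨τ, by omega, h.congr fun u hu => hOα u (by omega)⟩
    have h2 : x r ∈ witnessLang O ↔ (s r).1 = true := by
      have hfree : ∀ y : Y, interleave y.1 (x r) ∈ O ↔ s r = (true, y) := by
        intro y
        rw [hO, mem_codingOracle_of_freeWord, hZ _ (by rw [hlen]; omega), hmem]
        obtain ⟨_ | ⟨a, y⟩, hy⟩ := y
        · simp at hy
        · exact ⟨a, interleave y (e r).1, rfl⟩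
      constructor
      · rintro ⟨y, hy, h⟩
        rw [hx] at hy
        rw [(hfree ⟨y, hy⟩).1 h]
      · intro h
        exact ⟨(s r).2.1, hyx _ r, (hfree _).2 (Prod.ext h rfl)⟩
    apply hr
    rw [hlang] at h1
    exact Bool.eq_iff_iff.2 (h1.trans h2)

/-- Countably many requirements can be met together if each of them can be met by fixing a finite
part of the oracle, whatever finite part has been fixed before. -/
theorem exists_oracle_forall {P : ℕ → Oracle → Prop}
    (h : ∀ (k N : ℕ) (X : Oracle), ∃ N' ≥ N, ∃ X' : Oracle, (∀ u : Word, u.length < N → (u ∈ X' ↔ u ∈ X)) ∧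
      ∀ Z : Oracle, (∀ u : Word, u.length < N' → (u ∈ Z ↔ u ∈ X')) → P k Z) :
    ∃ Z, ∀ k, P k Z := by
  choose N' hN' X' hX' hP using h
  -- stage `k` has fixed the oracle on all words shorter than `(S k).1`
  let S : ℕ → ℕ × Oracle := fun k => Nat.rec (0, ∅)
    (fun k s => (N' k s.1 s.2 + 1, X' k s.1 s.2)) k
  have hS : ∀ k, S (k + 1) = (N' k (S k).1 (S k).2 + 1, X' k (S k).1 (S k).2) := fun _ => rfl
  clear_value S
  have hlt : ∀ k, (S k).1 < (S (k + 1)).1 := fun k => by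
    rw [hS]; exact Nat.lt_succ_of_le (hN' _ _ _)
  have hmono : StrictMono fun k => (S k).1 := strictMono_nat_of_lt_succ hlt
  have hstep : ∀ k (u : Word), u.length < (S k).1 → ∀ j, u ∈ (S (k + j)).2 ↔ u ∈ (S k).2 := by
    intro k u hu j
    induction j with
    | zero => rfl
    | succ j ih =>
      rw [← ih, ← add_assoc, hS]
      exact hX' _ _ _ u (hu.trans_le (hmono.monotone (by omega)))
  refine ⟨{u | u ∈ (S (u.length + 1)).2}, fun k => hP k (S k).1 (S k).2 _ fun u hu => ?_⟩
  have hk : X' k (S k).1 (S k).2 = (S (k + 1)).2 := by rw [hS]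
  rw [Set.mem_ofPred_eq, hk]
  have h1 : u.length < (S (u.length + 1)).1 := hmono.id_le (u.length + 1)
  have h2 : u.length < (S (k + 1)).1 := by rw [hS]; exact hu.trans (Nat.lt_succ_self _)
  have h3 := hstep _ u h2 (u.length + 1)
  rw [add_comm] at h3
  exact (hstep _ u h1 (k + 1)).symm.trans h3

/-- There is an `X` for which no deterministic polynomial-time machine decides `witnessLang`
relative to the coding oracle. -/
theorem exists_forall_lang_ne {E : ℕ → OracleTM} (hE : ∀ i, (E i).Deterministic)
    (hE' : ∀ M : OracleTM, M.Deterministic → ∃ i, M.Equivalent (E i))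
    {A : Bool → Oracle → Set Word} (hA : Local A) :
    ∃ X, witnessLang (codingOracle E (Sound E A) X) ∉ ClassP (codingOracle E (Sound E A) X) := by
  obtain ⟨X, hX⟩ := exists_oracle_forall (P := fun i Z => (E i).PolyTime →
      (E i).lang (codingOracle E (Sound E A) Z) ≠ witnessLang (codingOracle E (Sound E A) Z)) <| by
    intro i N X
    by_cases hp : (E i).PolyTime
    · obtain ⟨N', hN', X', h1, h2⟩ := exists_extension_lang_ne hE hA (hE i) hp N X
      exact ⟨N', hN', X', h1, fun Z hZ _ => h2 Z hZ⟩
    · exact ⟨N, le_rfl, X, fun _ _ => Iff.rfl, fun _ _ h => absurd h hp⟩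
  refine ⟨X, ?_⟩
  rintro ⟨M, hM, ⟨p, hp⟩, hL⟩
  obtain ⟨i, hi⟩ := hE' M hM
  refine hX i ⟨p, fun D x => (hi.2 D x _).1 (hp D x)⟩ ?_
  rw [← hL]
  ext x
  simp only [OracleTM.mem_lang_iff, hi.1]

/-! ### Building machines that scan their input -/

/-- An instruction that only moves the head of tape `0` and does not change any tape. -/
structure Instr (Q : Type) where
  dir : Option Dir
  next : Q
  query : Option Bool := none
  output : Option Bool := none

/-- The letter that a symbol stands for, if any. -/
def letter {Γ : Type} (s : TapeSymbol Γ) : Option Bool := s.bind Sum.getLeft?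

/-- The action that carries out an instruction when the symbols `s` are scanned. -/
def Instr.toAction {k : ℕ} {Q Γ : Type} (s : Fin (k + 1) → TapeSymbol Γ) (i : Instr Q) :
    Action k Q Γ where
  next := i.next
  write := s
  move := fun j => if j = 0 then i.dir else none
  query := i.query
  output := i.output

/-- The role of a state in which the possible instructions depend on the letter on tape `0`. -/
def scanRole {k : ℕ} {Q Γ : Type} (f : Option Bool → Set (Instr Q)) : Role k Q Γ :=
  .act fun s => Instr.toAction s '' f (letter (s 0))

/-- The tape that holds the word `l.reverse ++ r` with the head on the first letter of `r`. -/
def tapeAt {Γ : Type} (l r : Word) : Tape (TapeSymbol Γ) :=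
  Tape.mk₂ (l.map fun b => some (Sum.inl b)) (r.map fun b => some (Sum.inl b))

section tapeAt
variable {Γ : Type} (l r : Word) (b : Bool)

@[simp] theorem letter_tapeAt_nil : letter (tapeAt l [] : Tape (TapeSymbol Γ)).head = none := rfl

@[simp] theorem letter_tapeAt_cons :
    letter (tapeAt l (b :: r) : Tape (TapeSymbol Γ)).head = some b := rfl

@[simp] theorem tapeAt_cons_move_right :
    (tapeAt l (b :: r) : Tape (TapeSymbol Γ)).move .right = tapeAt (b :: l) r := by
  simp [tapeAt, Tape.mk₂, Tape.move_right_mk']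

@[simp] theorem tapeAt_cons_move_left :
    (tapeAt (b :: l) r : Tape (TapeSymbol Γ)).move .left = tapeAt l (b :: r) := by
  simp [tapeAt, Tape.mk₂, Tape.move_left_mk']

end tapeAt

namespace OracleTM

/-- The configuration after an instruction. -/
def Cfg.exec {M : OracleTM} (c : M.Cfg) (i : Instr M.State) : M.Cfg where
  state := i.next
  tape := fun j => if j = 0 then i.dir.elim (c.tape 0) fun d => (c.tape 0).move d else c.tape j
  query := c.query ++ i.query.toList
  output := c.output ++ i.output.toList

theorem next_scanRole {M : OracleTM} {c : M.Cfg} {f : Option Bool → Set (Instr M.State)}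
    (h : M.role c.state = scanRole f) (D : Oracle) :
    M.next D c = c.exec '' f (letter (c.tape 0).head) := by
  rw [next_act h, Set.image_image]
  refine Set.image_congr fun i _ => ?_
  simp only [Cfg.apply, Cfg.exec, Instr.toAction, Cfg.mk.injEq, true_and, and_true]
  funext j
  rw [show (c.tape j).write (c.tape j).head = c.tape j from Tape.write_self _]
  by_cases hj : j = 0
  · subst hj
    cases i.dir <;> simp
  · simp [hj]

/-- The configuration with all tapes but tape `0` blank. -/
def scanCfg (M : OracleTM) (q : M.State) (T : Tape (TapeSymbol M.Aux)) (u o : Word) : M.Cfg where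
  state := q
  tape := fun j => if j = 0 then T else Tape.mk₁ []
  query := u
  output := o

theorem init_eq_scanCfg (M : OracleTM) (x : Word) :
    M.init x = M.scanCfg M.start (tapeAt [] x) [] [] := rfl

theorem exec_scanCfg (M : OracleTM) (q : M.State) (T : Tape (TapeSymbol M.Aux)) (u o : Word)
    (i : Instr M.State) : (M.scanCfg q T u o).exec i =
      M.scanCfg i.next (i.dir.elim T fun d => T.move d) (u ++ i.query.toList)
        (o ++ i.output.toList) := by
  simp only [Cfg.exec, scanCfg, Cfg.mk.injEq, true_and, and_true]
  funext j
  by_cases hj : j = 0 <;> simp [hj]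

theorem next_scanCfg {M : OracleTM} {q : M.State} {f : Option Bool → Set (Instr M.State)}
    (h : M.role q = scanRole f) (D : Oracle) (T : Tape (TapeSymbol M.Aux)) (u o : Word) :
    M.next D (M.scanCfg q T u o) = (fun i : Instr M.State => M.scanCfg i.next
      (i.dir.elim T fun d => T.move d) (u ++ i.query.toList) (o ++ i.output.toList)) ''
        f (letter T.head) := by
  rw [next_scanRole (c := M.scanCfg q T u o) h]
  simp only [exec_scanCfg]
  rfl

/-- A configuration with property `P` can be reached from `c` within `n` steps. -/
def Leads (M : OracleTM) (D : Oracle) (c : M.Cfg) (n : ℕ) (P : M.Cfg → Prop) : Prop :=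
  ∃ m ≤ n, ∃ c', M.Reaches D m c c' ∧ P c'

theorem Leads.refl {M : OracleTM} {D : Oracle} {c : M.Cfg} {n : ℕ} {P : M.Cfg → Prop} (h : P c) :
    M.Leads D c n P := ⟨0, Nat.zero_le _, c, rfl, h⟩

theorem Leads.mono {M : OracleTM} {D : Oracle} {c : M.Cfg} {n n' : ℕ} {P P' : M.Cfg → Prop}
    (h : M.Leads D c n P) (hn : n ≤ n') (hP : ∀ c, P c → P' c) : M.Leads D c n' P' := by
  obtain ⟨m, hm, c', hc', h⟩ := h
  exact ⟨m, hm.trans hn, c', hc', hP _ h⟩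

theorem Leads.step {M : OracleTM} {D : Oracle} {c d : M.Cfg} {n : ℕ} {P : M.Cfg → Prop}
    (hd : d ∈ M.next D c) (h : M.Leads D d n P) : M.Leads D c (n + 1) P := by
  obtain ⟨m, hm, c', hc', h⟩ := h
  exact ⟨m + 1, by omega, c', ⟨d, hd, hc'⟩, h⟩

theorem Leads.scan {M : OracleTM} {D : Oracle} {q : M.State}
    {f : Option Bool → Set (Instr M.State)} (hq : M.role q = scanRole f)
    {T : Tape (TapeSymbol M.Aux)} {u o : Word} {n : ℕ} {P : M.Cfg → Prop} (i : Instr M.State)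
    (hi : i ∈ f (letter T.head))
    (h : M.Leads D (M.scanCfg i.next (i.dir.elim T fun d => T.move d) (u ++ i.query.toList)
      (o ++ i.output.toList)) n P) : M.Leads D (M.scanCfg q T u o) (n + 1) P := by
  refine Leads.step ?_ h
  rw [next_scanCfg hq]
  exact ⟨i, hi, rfl⟩

theorem Deterministic.polyTime {M : OracleTM} (hM : M.Deterministic) {p : Polynomial ℕ}
    (h : ∀ D x, M.Leads D (M.init x) (p.eval x.length) fun c => M.next D c = ∅) :
    M.PolyTime := by
  refine ⟨p, fun D x => ?_⟩
  obtain ⟨m, hm, c, hc, h⟩ := h D x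
  obtain ⟨τ, rfl, hτ⟩ := reaches_iff_exists_run.1 hc
  exact hM.stopsWithin hτ h hm

theorem subsingleton_scanRole {k : ℕ} {Q Γ : Type} {f : Option Bool → Set (Instr Q)}
    (hf : ∀ a, (f a).Subsingleton) {δ : (Fin (k + 1) → TapeSymbol Γ) → Set (Action k Q Γ)}
    (h : scanRole f = Role.act δ) (s : Fin (k + 1) → TapeSymbol Γ) : (δ s).Subsingleton := by
  cases h
  exact (hf _).image _

/-! ### The nondeterministic machine for `witnessLang` -/

/-- The states of `witnessMachine`. -/
inductive WitnessState
  | guess | copy | ask | yes | no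

theorem finite_witnessState : Finite WitnessState :=
  Finite.of_injective (fun q => match q with
    | .guess => (0 : Fin 5) | .copy => 1 | .ask => 2 | .yes => 3 | .no => 4) <| by
    rintro (_ | _) (_ | _) h <;> simp_all

open WitnessState in
/-- The instructions of `witnessMachine`. -/
def witnessInstr : WitnessState → Option Bool → Set (Instr WitnessState)
  | guess, some _ => Set.range fun a => { dir := none, next := copy, query := some a }
  | guess, none => {{ dir := none, next := ask }}
  | copy, some b => {{ dir := some .right, next := guess, query := some b }}
  | _, _ => ∅

open WitnessState in
/-- The machine writes a guessed letter before each letter of the input on the query tape,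
asks the query, and accepts if the answer is positive. -/
abbrev witnessMachine : OracleTM where
  k := 0
  State := WitnessState
  Aux := Empty
  finite_state := finite_witnessState
  finite_aux := inferInstance
  start := guess
  role
    | ask => .query yes no
    | yes => .halt true
    | no => .halt false
    | q => scanRole (witnessInstr q)

/-- The configurations of `witnessMachine`. -/
abbrev witnessCfg (q : WitnessState) (l r u o : Word) : witnessMachine.Cfg :=
  witnessMachine.scanCfg q (tapeAt l r) u o

theorem next_witness_guess_nil (D : Oracle) (l u o : Word) :
    witnessMachine.next D (witnessCfg .guess l [] u o) = {witnessCfg .ask l [] u o} := by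
  refine (next_scanCfg (M := witnessMachine) (q := .guess) (f := witnessInstr .guess) rfl D (tapeAt l []) u o).trans ?_
  simp [witnessInstr]

theorem next_witness_guess_cons (D : Oracle) (l r u o : Word) (b : Bool) :
    witnessMachine.next D (witnessCfg .guess l (b :: r) u o) =
      Set.range fun a => witnessCfg .copy l (b :: r) (u ++ [a]) o := by
  refine (next_scanCfg (M := witnessMachine) (q := .guess) (f := witnessInstr .guess) rfl D (tapeAt l (b :: r)) u o).trans ?_
  ext d
  simp [witnessInstr, eq_comm (a := d)]

theorem next_witness_copy (D : Oracle) (l r u o : Word) (b : Bool) :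
    witnessMachine.next D (witnessCfg .copy l (b :: r) u o) =
      {witnessCfg .guess (b :: l) r (u ++ [b]) o} := by
  refine (next_scanCfg (M := witnessMachine) (q := .copy) (f := witnessInstr .copy) rfl D (tapeAt l (b :: r)) u o).trans ?_
  simp [witnessInstr]

open Classical in
theorem next_witness_ask (D : Oracle) (l r u o : Word) :
    witnessMachine.next D (witnessCfg .ask l r u o) =
      {witnessCfg (if u ∈ D then .yes else .no) l r [] o} :=
  next_query (M := witnessMachine) (c := witnessCfg .ask l r u o) (yes := .yes) (no := .no) rfl D

theorem next_witness_halt (D : Oracle) (l r u o : Word) (P : Prop) [Decidable P] :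
    witnessMachine.next D (witnessCfg (if P then .yes else .no) l r u o) = ∅ := by
  split_ifs
  · exact next_halt (b := true) rfl D
  · exact next_halt (b := false) rfl D

theorem forall_reaches_le_succ {M : OracleTM} {D : Oracle} {c : M.Cfg} {n : ℕ}
    (h : ∀ d ∈ M.next D c, ∀ m c', M.Reaches D m d c' → m ≤ n) :
    ∀ m c', M.Reaches D m c c' → m ≤ n + 1 := by
  rintro (_ | m) c' hm
  · omega
  · obtain ⟨d, hd, hm⟩ := hm
    have := h d hd m c' hm
    omega

theorem witnessMachine_polyTime : witnessMachine.PolyTime := by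
  have key : ∀ (D : Oracle) (r l u o : Word) m c', witnessMachine.Reaches D m
      (witnessCfg .guess l r u o) c' → m ≤ 2 * r.length + 2 := by
    intro D r
    induction r with
    | nil =>
      intro l u o
      refine forall_reaches_le_succ (n := 1) fun d hd => ?_
      rw [next_witness_guess_nil] at hd
      cases hd
      refine forall_reaches_le_succ fun d hd => ?_
      rw [next_witness_ask] at hd
      cases hd
      rintro (_ | m) c' hm
      · omega
      · obtain ⟨d, hd, -⟩ := hm
        rw [next_witness_halt] at hd
        cases hd
    | cons b r ih =>
      intro l u o
      refine forall_reaches_le_succ (n := 2 * r.length + 3) fun d hd => ?_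
      rw [next_witness_guess_cons] at hd
      obtain ⟨a, rfl⟩ := hd
      refine forall_reaches_le_succ fun d hd => ?_
      rw [next_witness_copy] at hd
      cases hd
      exact ih (b :: l) _ _
  refine ⟨2 * Polynomial.X + 2, fun D x m c h => ?_⟩
  simpa using key D x [] [] [] m c h

/-- An accepting configuration can be reached from `c`. -/
def Accepts (M : OracleTM) (D : Oracle) (c : M.Cfg) : Prop :=
  ∃ m c', M.Reaches D m c c' ∧ M.role c'.state = .halt true

theorem accepts_iff {M : OracleTM} {D : Oracle} {c : M.Cfg} :
    M.Accepts D c ↔ M.role c.state = .halt true ∨ ∃ d ∈ M.next D c, M.Accepts D d := by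
  constructor
  · rintro ⟨_ | m, c', h, hr⟩
    · cases h; exact Or.inl hr
    · obtain ⟨d, hd, h⟩ := h; exact Or.inr ⟨d, hd, m, c', h, hr⟩
  · rintro (h | ⟨d, hd, m, c', h, hr⟩)
    · exact ⟨0, c, rfl, h⟩
    · exact ⟨m + 1, c', ⟨d, hd, h⟩, hr⟩

theorem witnessMachine_accepts_iff (D : Oracle) (l r u o : Word) :
    witnessMachine.Accepts D (witnessCfg .guess l r u o) ↔
      ∃ y : Word, y.length = r.length ∧ u ++ interleave y r ∈ D := by
  have hact : ∀ (q : WitnessState) (l r u o : Word), q = .guess ∨ q = .copy ∨ q = .ask →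
      witnessMachine.role (witnessCfg q l r u o).state ≠ .halt true := by
    rintro q l r u o (rfl | rfl | rfl) h <;> cases h
  induction r generalizing l u with
  | nil =>
    rw [accepts_iff, or_iff_right (hact .guess _ _ _ _ (by simp)), next_witness_guess_nil]
    simp only [Set.mem_singleton_iff, exists_eq_left]
    rw [accepts_iff, or_iff_right (hact .ask _ _ _ _ (by simp)), next_witness_ask]
    simp only [Set.mem_singleton_iff, exists_eq_left, List.length_nil, List.length_eq_zero_iff]
    rw [accepts_iff, next_witness_halt]
    by_cases h : u ∈ D
    · simp [h, scanCfg, interleave]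
    · simp [h, scanCfg, interleave]
  | cons b r ih =>
    rw [accepts_iff, or_iff_right (hact .guess _ _ _ _ (by simp)), next_witness_guess_cons]
    simp only [Set.exists_range_iff]
    have hcopy : ∀ a, witnessMachine.Accepts D (witnessCfg .copy l (b :: r) (u ++ [a]) o) ↔
        ∃ y : Word, y.length = r.length ∧ u ++ interleave (a :: y) (b :: r) ∈ D := by
      intro a
      rw [accepts_iff, or_iff_right (hact .copy _ _ _ _ (by simp)), next_witness_copy]
      simp only [Set.mem_singleton_iff, exists_eq_left]
      exact (ih (b :: l) (u ++ [a] ++ [b])).trans (by simp [interleave])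
    simp only [hcopy]
    constructor
    · rintro ⟨a, y, hy, h⟩
      exact ⟨a :: y, by simp [hy], h⟩
    · rintro ⟨_ | ⟨a, y⟩, hy, h⟩
      · simp at hy
      · exact ⟨a, y, by simpa using hy, h⟩

theorem witnessMachine_lang (D : Oracle) : witnessMachine.lang D = witnessLang D := by
  ext x
  rw [witnessLang, Set.mem_ofPred_eq]
  refine Iff.trans ?_ (by simpa using witnessMachine_accepts_iff D [] x [] [])
  constructor
  · rintro ⟨t, m, -, c, h, hr⟩; exact ⟨m, c, h, hr⟩
  · rintro ⟨m, c, h, hr⟩; exact ⟨m, m, le_rfl, c, h, hr⟩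

end OracleTM

theorem witnessLang_mem_classNP (O : Oracle) : witnessLang O ∈ ClassNP O :=
  ⟨OracleTM.witnessMachine, OracleTM.witnessMachine_polyTime, OracleTM.witnessMachine_lang O⟩

/-! ### The machine that computes the optimal proof system -/

/-- The states of `proofMachine`; in state `fallback j` the first `j` letters of the default output
have been written. -/
inductive ProofState (n : ℕ)
  | tag | mark | copy | ask | back | header | skip | steps | bit | done
  | fallback (j : Fin (n + 1))

theorem finite_proofState (n : ℕ) : Finite (ProofState n) :=
  Finite.of_injective (fun q => match q with
    | .tag => Sum.inl (0 : Fin 10) | .mark => .inl 9 | .copy => .inl 1 | .ask => .inl 2 | .back => .inl 3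
    | .header => .inl 4 | .skip => .inl 5 | .steps => .inl 6 | .bit => .inl 7 | .done => .inl 8
    | .fallback j => Sum.inr j) <| by
    rintro (_ | _) (_ | _) h <;> simp_all

open ProofState in
/-- The instructions of `proofMachine`. -/
def proofInstr (c : Bool) (z : Word) :
    ProofState z.length → Option Bool → Instr (ProofState z.length)
  | tag, _ => { dir := none, next := mark, query := some c }
  | mark, _ => { dir := none, next := copy, query := some true }
  | copy, some b => { dir := some .right, next := copy, query := some b }
  | copy, none => { dir := some .left, next := ask }
  | back, some _ => { dir := some .left, next := back }
  | back, none => { dir := some .right, next := header }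
  | header, some true => { dir := some .right, next := skip }
  | header, some false => { dir := some .right, next := steps }
  | skip, some _ => { dir := some .right, next := header }
  | steps, some false => { dir := some .right, next := steps }
  | steps, some true => { dir := some .right, next := bit }
  | bit, some b => { dir := some .right, next := steps, output := some b }
  | fallback j, _ =>
    { dir := none, next := if h : j.1 < z.length then fallback ⟨j.1 + 1, by omega⟩ else done,
      output := z[j.1]? }
  | _, _ => { dir := none, next := done }

open ProofState in
/-- With `start = tag`, the machine asks on input `w` whether `c :: true :: w` belongs to the oracle; it writes
`decode w` if so and the default output `z` if not. With `start = fallback 0` it always writes `z`. -/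
abbrev proofMachine (c : Bool) (z : Word) (start : ProofState z.length) : OracleTM where
  k := 0
  State := ProofState z.length
  Aux := Empty
  finite_state := finite_proofState _
  finite_aux := inferInstance
  start := start
  role
    | ask => .query back (fallback 0)
    | done => .halt true
    | q => scanRole fun a => {proofInstr c z q a}

namespace OracleTM

theorem proofMachine_deterministic (c : Bool) (z : Word) (start : ProofState z.length) :
    (proofMachine c z start).Deterministic := by
  intro q δ h s
  cases q
  case ask => cases h
  case done => cases h
  all_goals exact subsingleton_scanRole (fun _ => Set.subsingleton_singleton) h s

/-- `M` halts from `c` within `n` steps with output `o`. -/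
def HaltsFrom (M : OracleTM) (D : Oracle) (c : M.Cfg) (n : ℕ) (o : Word) : Prop :=
  M.Leads D c n fun c' => M.role c'.state = .halt true ∧ c'.output = o

theorem HaltsFrom.cast {M : OracleTM} {D : Oracle} {c : M.Cfg} {n n' : ℕ} {o o' : Word}
    (h : M.HaltsFrom D c n o) (hn : n ≤ n') (ho : o = o') : M.HaltsFrom D c n' o' :=
  h.mono hn fun _ hc => ⟨hc.1, hc.2.trans ho⟩

section proofMachine
variable (D : Oracle) (c : Bool) (z : Word) (start : ProofState z.length) (l r u o : Word)

/-- The configurations of `proofMachine`. -/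
abbrev proofCfg (q : ProofState z.length) (T : Tape (TapeSymbol Empty)) (u o : Word) :
    (proofMachine c z start).Cfg :=
  (proofMachine c z start).scanCfg q T u o

theorem proofMachine_step {q : ProofState z.length}
    (hq : (proofMachine c z start).role q = scanRole fun a => {proofInstr c z q a})
    {T : Tape (TapeSymbol Empty)} {a : Option Bool} (ha : letter T.head = a) {n : ℕ} {v : Word}
    (h : HaltsFrom _ D (proofCfg c z start (proofInstr c z q a).next
      ((proofInstr c z q a).dir.elim T fun d => T.move d)
      (u ++ (proofInstr c z q a).query.toList) (o ++ (proofInstr c z q a).output.toList)) n v) :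
    HaltsFrom _ D (proofCfg c z start q T u o) (n + 1) v :=
  Leads.scan (M := proofMachine c z start) hq (proofInstr c z q a) (by rw [ha]; rfl) h

theorem haltsFrom_done (T : Tape (TapeSymbol Empty)) (n : ℕ) :
    HaltsFrom _ D (proofCfg c z start .done T u o) n o :=
  Leads.refl ⟨rfl, rfl⟩

theorem haltsFrom_steps : HaltsFrom _ D (proofCfg c z start .steps (tapeAt l r) u o)
    (r.length + 1) (o ++ decodeSteps r) := by
  induction hn : r.length using Nat.strong_induction_on generalizing l r o with
  | _ n ih =>
    subst hn
    match r with
    | [] =>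
      refine proofMachine_step D c z start u o rfl (a := none) rfl ?_
      simpa [proofInstr, decodeSteps] using haltsFrom_done D c z start u o _ 0
    | false :: r =>
      refine proofMachine_step D c z start u o rfl (a := some false) rfl ?_
      simpa [proofInstr, decodeSteps] using ih r.length (by simp) (false :: l) r o rfl
    | [true] =>
      refine proofMachine_step D c z start u o rfl (a := some true) rfl ?_
      refine proofMachine_step D c z start _ _ (q := .bit) rfl (a := none) ?_ ?_
      · simp [proofInstr]
      simpa [proofInstr, decodeSteps] using haltsFrom_done D c z start u o _ 0
    | true :: b :: r =>
      refine proofMachine_step D c z start u o rfl (a := some true) rfl ?_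
      refine proofMachine_step D c z start _ _ (q := .bit) rfl (a := some b) ?_ ?_
      · simp [proofInstr]
      simpa [proofInstr, decodeSteps] using
        ih r.length (by simp) (b :: true :: l) r (o ++ [b]) rfl

theorem haltsFrom_header : HaltsFrom _ D (proofCfg c z start .header (tapeAt l r) u o)
    (r.length + 1) (o ++ decode r) := by
  induction hn : r.length using Nat.strong_induction_on generalizing l r with
  | _ n ih =>
    subst hn
    match r with
    | [] =>
      refine proofMachine_step D c z start u o rfl (a := none) rfl ?_
      simpa [proofInstr, decode] using haltsFrom_done D c z start u o _ 0
    | false :: r =>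
      refine proofMachine_step D c z start u o rfl (a := some false) rfl ?_
      simpa [proofInstr, decode] using haltsFrom_steps D c z start (false :: l) r u o
    | [true] =>
      refine proofMachine_step D c z start u o rfl (a := some true) rfl ?_
      refine proofMachine_step D c z start _ _ (q := .skip) rfl (a := none) ?_ ?_
      · simp [proofInstr]
      simpa [proofInstr, decode] using haltsFrom_done D c z start u o _ 0
    | true :: b :: r =>
      refine proofMachine_step D c z start u o rfl (a := some true) rfl ?_
      refine proofMachine_step D c z start _ _ (q := .skip) rfl (a := some b) ?_ ?_
      · simp [proofInstr]
      simpa [proofInstr, decode] using ih r.length (by simp) (b :: true :: l) r rfl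

theorem haltsFrom_back :
    HaltsFrom _ D (proofCfg c z start .back ((tapeAt l r).move .left) u o)
      (l.length + (l.length + r.length + 1) + 1) (o ++ decode (l.reverse ++ r)) := by
  induction l generalizing r with
  | nil =>
    refine proofMachine_step D c z start u o rfl (a := none) rfl ?_
    simpa [proofInstr] using haltsFrom_header D c z start [] r u o
  | cons b l ih =>
    rw [tapeAt_cons_move_left]
    refine HaltsFrom.cast (proofMachine_step D c z start u o (q := .back) rfl (a := some b)
      (letter_tapeAt_cons l r b) (by simpa [proofInstr] using ih (b :: r))) ?_ ?_
    · simp; omega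
    · simp

theorem haltsFrom_fallback (T : Tape (TapeSymbol Empty)) (j : Fin (z.length + 1)) :
    HaltsFrom _ D (proofCfg c z start (.fallback j) T u o) (z.length - j + 1)
      (o ++ z.drop j) := by
  induction hn : z.length - j.1 generalizing j o with
  | zero =>
    refine proofMachine_step D c z start u o rfl (a := letter T.head) rfl ?_
    have hj : ¬ j.1 < z.length := by omega
    rw [List.drop_eq_nil_of_le (by omega : z.length ≤ j.1)]
    simpa [proofInstr, hj] using haltsFrom_done D c z start u o _ 0
  | succ n ih =>
    refine proofMachine_step D c z start u o rfl (a := letter T.head) rfl ?_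
    have hj : j.1 < z.length := by omega
    have := ih (o ++ [z[j.1]]) ⟨j.1 + 1, by omega⟩ (by simp; omega)
    rw [List.drop_eq_getElem_cons hj]
    simpa [proofInstr, hj] using this

open Classical in
/-- The head is behind `l.reverse`, which has been copied already, and the query tape holds `u`. -/
theorem haltsFrom_copy : HaltsFrom _ D (proofCfg c z start .copy (tapeAt l r) u o)
    (r.length + (2 * (l.length + r.length) + z.length + 4))
    (o ++ if u ++ r ∈ D then decode (l.reverse ++ r) else z) := by
  induction r generalizing l u with
  | nil =>
    have key : HaltsFrom _ D (proofCfg c z start .ask ((tapeAt l []).move .left) u o)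
        (2 * l.length + z.length + 2 + 1)
        (o ++ if u ∈ D then decode (l.reverse ++ []) else z) := by
      have hnext := next_query (M := proofMachine c z start)
        (c := proofCfg c z start .ask ((tapeAt l []).move .left) u o) (yes := .back)
        (no := .fallback 0) rfl D
      refine Leads.step (by rw [hnext]; rfl) ?_
      by_cases h : u ∈ D
      · simp only [scanCfg, h, if_true]
        exact (haltsFrom_back D c z start l [] [] o).cast (by simp; omega) rfl
      · simp only [scanCfg, h, if_false]
        exact (haltsFrom_fallback D c z start [] o _ 0).cast (by simp; omega) (by simp)
    refine HaltsFrom.cast (proofMachine_step D c z start u o (q := .copy) rfl (a := none)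
      (letter_tapeAt_nil l) (by simpa [proofInstr] using key)) ?_ ?_
    · simp
    · simp
  | cons b r ih =>
    refine HaltsFrom.cast (proofMachine_step D c z start u o (q := .copy) rfl (a := some b)
      (letter_tapeAt_cons l r b) (by simpa [proofInstr] using ih (b :: l) (u ++ [b]))) ?_ ?_
    · simp; omega
    · simp

open Classical in
theorem haltsFrom_tag (x : Word) : HaltsFrom _ D ((proofMachine c z .tag).init x)
    (3 * x.length + z.length + 6) (if c :: true :: x ∈ D then decode x else z) := by
  rw [init_eq_scanCfg]
  refine HaltsFrom.cast (proofMachine_step D c z .tag [] [] (q := .tag) rfl (T := tapeAt [] x) rfl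
    (proofMachine_step D c z .tag _ _ (q := .mark) rfl rfl
      (by simpa [proofInstr] using haltsFrom_copy D c z .tag [] x [c, true] []))) ?_ ?_
  · simp; omega
  · simp

end proofMachine

theorem Deterministic.polyTime_of_haltsFrom {M : OracleTM} (hM : M.Deterministic)
    {p : Polynomial ℕ} {f : Oracle → Word → Word}
    (h : ∀ D x, M.HaltsFrom D (M.init x) (p.eval x.length) (f D x)) :
    M.PolyTime ∧ ∀ D, M.Computes D (f D) := by
  refine ⟨hM.polyTime (p := p) fun D x => (h D x).mono le_rfl fun c hc => next_halt hc.1 D,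
    fun D x => ?_⟩
  obtain ⟨m, -, c, hc, hr, ho⟩ := h D x
  exact ⟨m, c, true, hc, hr, ho⟩

/-- Every word is the constant output of some deterministic machine. -/
theorem exists_computes_const (z : Word) : ∃ M : OracleTM, M.Deterministic ∧
    ∀ D, M.Computes D fun _ => z := by
  refine ⟨proofMachine true z (.fallback 0), proofMachine_deterministic _ _ _, ?_⟩
  refine ((proofMachine_deterministic _ _ _).polyTime_of_haltsFrom (p := Polynomial.C z.length + 1)
    (f := fun _ _ => z) fun D x => ?_).2
  simpa [init_eq_scanCfg] using haltsFrom_fallback D true z (.fallback 0) [] [] (tapeAt [] x) 0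

end OracleTM

open Classical in
/-- The proof system computed by `proofMachine`. -/
noncomputable def proofSystem (O : Oracle) (c : Bool) (z w : Word) : Word :=
  if c :: true :: w ∈ O then decode w else z

theorem proofSystem_mem_classFP (O : Oracle) (c : Bool) (z : Word) :
    proofSystem O c z ∈ ClassFP O := by
  have hM := OracleTM.proofMachine_deterministic c z .tag
  have h := hM.polyTime_of_haltsFrom (p := 3 * Polynomial.X + Polynomial.C z.length + 6)
    (f := fun D => proofSystem D c z) fun D x => by
      simpa [proofSystem] using OracleTM.haltsFrom_tag D c z x
  exact ⟨_, hM, h.1, h.2 O⟩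

/-! ### The machine that writes the trace of another machine -/

/-- The states of `traceMachine`: in state `pre j` the first `j` letters of the constant prefix have
been written, `first`, `second` and `back` copy the input, `main q` simulates the state `q`, and
`emit q b` writes `b` before the simulation continues with `q`. -/
inductive TraceState (n : ℕ) (Q : Type)
  | first | second | back
  | pre (j : Fin (n + 1))
  | main (q : Q)
  | emit (q : Q) (b : Bool)

theorem finite_traceState (n : ℕ) (Q : Type) [Finite Q] : Finite (TraceState n Q) :=
  Finite.of_injective (fun q => match q with
    | .first => Sum.inl (0 : Fin 3) | .second => .inl 1 | .back => .inl 2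
    | .pre j => .inr (.inl j) | .main q => .inr (.inr (q, none))
    | .emit q b => .inr (.inr (q, some b)) :
    TraceState n Q → Fin 3 ⊕ Fin (n + 1) ⊕ Q × Option Bool) <| by
    rintro (_ | _) (_ | _) h <;> simp_all

open TraceState in
/-- The instructions of `traceMachine` in states that do not simulate a step. -/
def traceInstr (p : Word) {Q : Type} (start : Q) :
    TraceState p.length Q → Option Bool → Instr (TraceState p.length Q)
  | pre j, _ =>
    { dir := none, next := if h : j.1 < p.length then pre ⟨j.1 + 1, by omega⟩ else first,
      output := p[j.1]? }
  | first, some _ => { dir := none, next := second, output := some true }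
  | first, none => { dir := some .left, next := back, output := some false }
  | second, b => { dir := some .right, next := first, output := b }
  | back, some _ => { dir := some .left, next := back }
  | back, none => { dir := some .right, next := main start }
  | emit q b, _ => { dir := none, next := main q, output := some b }
  | main q, _ => { dir := none, next := main q }

/-- The action that simulates `a` but writes the first letter of `stepCode a.output`. -/
def Action.traced {k n : ℕ} {Q Γ : Type} (a : Action k Q Γ) : Action k (TraceState n Q) Γ where
  next := match a.output with
    | none => .main a.next
    | some b => .emit a.next b
  write := a.write
  move := a.move
  query := a.query
  output := some a.output.isSome

open TraceState in
/-- The machine writes the word `p` and the header code of its input, and then the code of the trace of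
`M` on this input. -/
abbrev traceMachine (M : OracleTM) (p : Word) : OracleTM where
  k := M.k
  State := TraceState p.length M.State
  Aux := M.Aux
  finite_state := have := M.finite_state; finite_traceState _ _
  finite_aux := M.finite_aux
  start := pre 0
  role
    | main q => match M.role q with
      | .halt b => .halt b
      | .query yes no => .query (emit yes false) (emit no false)
      | .act δ => .act fun s => Action.traced '' δ s
    | q => scanRole fun a => {traceInstr p M.start q a}

namespace OracleTM

theorem traceMachine_deterministic {M : OracleTM} (hM : M.Deterministic) (p : Word) :
    (traceMachine M p).Deterministic := by
  intro q δ h s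
  cases q
  case main q =>
    cases hr : M.role q with
    | halt b => simp [hr] at h
    | query yes no => simp [hr] at h
    | act δ' =>
      simp only [hr] at h
      cases h
      exact (hM _ _ hr _).image _
  all_goals exact subsingleton_scanRole (fun _ => Set.subsingleton_singleton) h s

section traceMachine
variable {M : OracleTM} (p : Word) {D : Oracle}

/-- The configuration of `traceMachine` that simulates the configuration `c` after the output `o`. -/
def Cfg.traced (c : M.Cfg) (o : Word) : (traceMachine M p).Cfg where
  state := .main c.state
  tape := c.tape
  query := c.query
  output := o

theorem next_traced_eq_empty {c : M.Cfg} (h : M.next D c = ∅) (o : Word) :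
    (traceMachine M p).next D (c.traced p o) = ∅ := by
  cases hr : M.role c.state with
  | halt b => exact next_halt (b := b) (by simp [Cfg.traced, hr]) D
  | query yes no => simp [next_query hr] at h
  | act δ =>
    rw [next_act hr, Set.image_eq_empty] at h
    rw [next_act (M := traceMachine M p) (c := c.traced p o) (δ := fun s => Action.traced '' δ s)
      (by simp [Cfg.traced, hr])]
    simp [Cfg.traced, h]

theorem leads_emit {c : (traceMachine M p).Cfg} {q : M.State} {b : Bool}
    (hc : c.state = .emit q b) {n : ℕ} {P : (traceMachine M p).Cfg → Prop}
    (h : (traceMachine M p).Leads D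
      ⟨.main q, c.tape, c.query, c.output ++ [b]⟩ n P) :
    (traceMachine M p).Leads D c (n + 1) P := by
  refine Leads.step ?_ h
  rw [next_scanRole (M := traceMachine M p) (f := fun a => {traceInstr p M.start (.emit q b) a}) (by rw [hc])]
  refine ⟨_, rfl, ?_⟩
  simp [Cfg.exec, traceInstr]
  funext j
  by_cases hj : j = 0 <;> simp [hj]

open Classical in
/-- Each step of `M` is simulated by at most two steps. -/
theorem leads_traced {τ : List (Option Bool)} {c c' : M.Cfg} (h : M.Run D τ c c') (o : Word) :
    (traceMachine M p).Leads D (c.traced p o) (2 * τ.length)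
      fun d => d = c'.traced p (o ++ τ.flatMap stepCode) := by
  induction τ generalizing c o with
  | nil => cases h; exact Leads.refl (by simp)
  | cons a τ ih =>
    obtain ⟨d, hd, ho, h⟩ := h
    have key : (traceMachine M p).Leads D (c.traced p o) (2 * τ.length + 1 + 1)
        fun e => e = c'.traced p (o ++ stepCode a ++ τ.flatMap stepCode) := by
      cases hr : M.role c.state with
      | halt b => simp [next_halt hr] at hd
      | query yes no =>
        rw [next_query hr, Set.mem_singleton_iff] at hd
        subst hd
        obtain rfl : a = none := by
          cases a <;> simp at ho ⊢
        have hnext := next_query (M := traceMachine M p) (c := c.traced p o)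
          (yes := .emit yes false) (no := .emit no false) (by simp [Cfg.traced, hr]) D
        refine Leads.step (by rw [hnext]; rfl) ?_
        refine leads_emit p (q := if c.query ∈ D then yes else no) (b := false) ?_ ?_
        · by_cases hq : c.query ∈ D <;> simp [Cfg.traced, hq]
        · exact ih h (o ++ [false])
      | act δ =>
        rw [next_act hr] at hd
        obtain ⟨b, hb, rfl⟩ := hd
        obtain rfl : a = b.output := by
          simp only [Cfg.apply, List.append_cancel_left_eq] at ho
          cases a <;> cases hb' : b.output <;> simp_all
        have hnext := next_act (M := traceMachine M p) (c := c.traced p o)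
          (δ := fun s => Action.traced '' δ s) (by simp [Cfg.traced, hr]) D
        refine Leads.step (d := (c.traced p o).apply b.traced)
          (by rw [hnext]; exact ⟨_, ⟨b, hb, rfl⟩, rfl⟩) ?_
        cases hbo : b.output with
        | none =>
          have he : (c.traced p o).apply b.traced = (c.apply b).traced p (o ++ [false]) := by
            simp [Cfg.traced, Cfg.apply, Action.traced, hbo]
          rw [he]
          exact (ih h (o ++ [false])).mono (by omega) fun _ => id
        | some a =>
          exact leads_emit p (q := b.next) (b := a)
            (by simp [Cfg.traced, Cfg.apply, Action.traced, hbo])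
            (by simpa [Cfg.traced, Cfg.apply, Action.traced, hbo, stepCode] using
              ih h (o ++ [true, a]))
    refine key.mono (by simp; omega) fun e he => ?_
    simpa using he

theorem traceMachine_step {q : TraceState p.length M.State}
    (hq : (traceMachine M p).role q = scanRole fun a => {traceInstr p M.start q a})
    {T : Tape (TapeSymbol M.Aux)} {u o : Word} {n : ℕ} {P : (traceMachine M p).Cfg → Prop}
    {a : Option Bool} (ha : letter T.head = a)
    (h : (traceMachine M p).Leads D ((traceMachine M p).scanCfg (traceInstr p M.start q a).next
      ((traceInstr p M.start q a).dir.elim T fun d => T.move d)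
      (u ++ (traceInstr p M.start q a).query.toList)
      (o ++ (traceInstr p M.start q a).output.toList)) n P) :
    (traceMachine M p).Leads D ((traceMachine M p).scanCfg q T u o) (n + 1) P :=
  Leads.scan (M := traceMachine M p) hq (traceInstr p M.start q a) (by rw [ha]; rfl) h

variable {n : ℕ} {P : (traceMachine M p).Cfg → Prop}

theorem leads_back (l r o : Word)
    (h : (traceMachine M p).Leads D ((M.init (l.reverse ++ r)).traced p o) n P) :
    (traceMachine M p).Leads D ((traceMachine M p).scanCfg .back ((tapeAt l r).move .left) [] o)
      (n + 1 + l.length) P := by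
  induction l generalizing r with
  | nil =>
    refine traceMachine_step p rfl (a := none) rfl ?_
    have : (M.init r).traced p o =
      (traceMachine M p).scanCfg (.main M.start) (tapeAt [] r) [] o := rfl
    rw [List.reverse_nil, List.nil_append, this] at h
    simpa [traceInstr] using h
  | cons b l ih =>
    rw [tapeAt_cons_move_left]
    refine traceMachine_step p rfl (a := some b) (letter_tapeAt_cons l r b) ?_
    simpa [traceInstr] using ih (b :: r) (by simpa using h)

theorem leads_first (l r o : Word)
    (h : (traceMachine M p).Leads D ((M.init (l.reverse ++ r)).traced p
      (o ++ headerCode r)) n P) :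
    (traceMachine M p).Leads D ((traceMachine M p).scanCfg .first (tapeAt l r) [] o)
      (n + l.length + 3 * r.length + 2) P := by
  induction r generalizing l o with
  | nil =>
    refine traceMachine_step p rfl (a := none) rfl ?_
    have := leads_back p l [] (o ++ [false]) (by simpa [headerCode] using h)
    simpa [traceInstr] using this.mono (by omega) fun _ => id
  | cons b r ih =>
    refine Leads.mono (n := n + (l.length + 1) + 3 * r.length + 2 + 1 + 1) ?_ (by simp; omega)
      fun _ => id
    refine traceMachine_step p rfl (a := some b) rfl ?_
    refine traceMachine_step p (q := .second) rfl (a := some b) ?_ ?_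
    · simp [traceInstr]
    · have := ih (b :: l) (o ++ [true, b]) (by simpa [headerCode] using h)
      simpa [traceInstr] using this.mono (by simp) fun _ => id

theorem leads_pre (x o : Word) (j : Fin (p.length + 1))
    (h : (traceMachine M p).Leads D ((M.init x).traced p
      (o ++ p.drop j ++ headerCode x)) n P) :
    (traceMachine M p).Leads D ((traceMachine M p).scanCfg (.pre j) (tapeAt [] x) [] o)
      (n + 3 * x.length + 3 + (p.length - j)) P := by
  induction hn : p.length - j.1 generalizing j o with
  | zero =>
    refine traceMachine_step p rfl rfl ?_
    have hj : ¬ j.1 < p.length := by omega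
    rw [List.drop_eq_nil_of_le (by omega : p.length ≤ j.1), List.append_nil] at h
    have := leads_first p [] x o (by simpa using h)
    simpa [traceInstr, hj] using this
  | succ m ih =>
    refine traceMachine_step p rfl rfl ?_
    have hj : j.1 < p.length := by omega
    rw [List.drop_eq_getElem_cons hj] at h
    have := ih (o ++ [p[j.1]]) ⟨j.1 + 1, by omega⟩ (by simpa using h) (by simp; omega)
    simpa [traceInstr, hj] using this

theorem leads_init_traced {x : Word} {τ : List (Option Bool)} {c : M.Cfg}
    (h : M.Run D τ (M.init x) c) :
    (traceMachine M p).Leads D ((traceMachine M p).init x)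
      (2 * τ.length + 3 * x.length + 3 + p.length)
      fun d => d = c.traced p (p ++ headerCode x ++ τ.flatMap stepCode) := by
  rw [init_eq_scanCfg]
  exact leads_pre p x [] 0 (by simpa using leads_traced p h (p ++ headerCode x))

end traceMachine
end OracleTM

theorem traceCode_eq (i : ℕ) (x : Word) (τ : List (Option Bool)) :
    traceCode i x τ = (zeros i ++ [true]).flatMap (fun b => [true, b]) ++ headerCode x ++
      τ.flatMap stepCode := by
  simp [traceCode, headerCode]

/-- The code of the halting computation of `M` on input `x` can be computed from `x` in polynomial
time: `traceMachine` runs no longer than a constant multiple of the time of `M`, also relative to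
oracles for which `M` gets stuck. -/
theorem traceCode_mem_classFP {M : OracleTM} (hM : M.Deterministic) (hp : M.PolyTime)
    {O : Oracle} (i : ℕ) {τ : Word → List (Option Bool)}
    (hτ : ∀ x, ∃ b, M.HaltsWith O x (τ x) b) :
    (fun x => traceCode i x (τ x)) ∈ ClassFP O := by
  obtain ⟨P, hP⟩ := hp
  let p : Word := (zeros i ++ [true]).flatMap fun b => [true, b]
  have hdet := OracleTM.traceMachine_deterministic hM p
  refine ⟨traceMachine M p, hdet, ?_, fun x => ?_⟩
  · refine hdet.polyTime (p := 2 * P + 3 * Polynomial.X + 3 + Polynomial.C p.length)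
      fun D x => ?_
    obtain ⟨σ, c, hc, hstuck, hσ⟩ := (hP D x).exists_stuck
    refine (OracleTM.leads_init_traced p hc).mono (by simp; omega) ?_
    rintro _ rfl
    exact OracleTM.next_traced_eq_empty p hstuck _
  · obtain ⟨b, c, hc, hr⟩ := hτ x
    obtain ⟨m, -, d, hd, rfl⟩ := OracleTM.leads_init_traced p hc
    refine ⟨m, _, b, hd, ?_, (traceCode_eq i x (τ x)).symm⟩
    simp [OracleTM.Cfg.traced, hr]

theorem exists_polynomial_length_le {O : Oracle} {f : Word → Word} (hf : f ∈ ClassFP O) :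
    ∃ p : Polynomial ℕ, ∀ x, (f x).length ≤ p.eval x.length := by
  obtain ⟨M, -, ⟨p, hp⟩, hc⟩ := hf
  refine ⟨p, fun x => ?_⟩
  obtain ⟨τ, b, ⟨c, h, -⟩, ho⟩ := OracleTM.computes_iff.1 hc x
  rw [← ho]
  exact (τ.reduceOption_length_le).trans (OracleTM.stopsWithin_iff.1 (hp O x) τ c h)

/-! ### Optimality -/

section Optimality
variable {E : ℕ → OracleTM} {A : Bool → Oracle → Set Word} {X : Oracle}

/-- Codes of computations of a machine that is sound at all lengths belong to the oracle. -/
theorem cons_traceCode_mem {c : Bool} {i : ℕ} {x : Word} {τ : List (Option Bool)} {b : Bool}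
    (hA : Local A) (hs : ∀ T, Sound E A (codingOracle E (Sound E A) X) c i T)
    (hx : (E i).HaltsWith (codingOracle E (Sound E A) X) x τ b) :
    c :: true :: traceCode i x τ ∈ codingOracle E (Sound E A) X := by
  have hlen := length_le_traceCode i x τ
  have hD : ∀ u : Word, u.length < τ.length → (u ∈ codingOracle E (Sound E A) X ↔
      u ∈ below (codingOracle E (Sound E A) X) (c :: true :: traceCode i x τ).length) :=
    fun u hu => (mem_below (by simp; omega)).symm
  rw [mem_codingOracle]
  exact Or.inr ⟨c, i, x, τ, b, rfl, (hs _).congr hA hD, hx.congr hD⟩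

/-- Soundness was tested relative to the shorter words of the oracle, which decide membership of the
output in the set relative to the whole oracle. -/
theorem decode_mem {c : Bool} {w : Word} (hA : Local A)
    (hw : c :: true :: w ∈ codingOracle E (Sound E A) X) :
    decode w ∈ A c (codingOracle E (Sound E A) X) := by
  rw [mem_codingOracle, or_iff_right (fun h => by simp [FreeWord] at h)] at hw
  obtain ⟨c', i, x, τ, b, h, hs, hx⟩ := hw
  obtain ⟨rfl, -, rfl⟩ : c = c' ∧ True ∧ w = traceCode i x τ := by simpa using h
  rw [decode_traceCode]
  have hlen := length_le_traceCode i x τ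
  have := τ.reduceOption_length_le
  exact hA _ _ _ _ (fun u hu => mem_below (by simp; omega)) (hs x τ b rfl hx)

theorem sound_of_computes {M : OracleTM} (hM : M.Deterministic) {c : Bool} {i : ℕ} {O : Oracle}
    (hi : M.Equivalent (E i)) {f : Word → Word} (hf : M.Computes O f) (hA : ∀ x, f x ∈ A c O)
    (T : ℕ) : Sound E A O c i T := by
  intro x τ b _ h
  obtain ⟨σ, b', hσ, ho⟩ := OracleTM.computes_iff.1 hf x
  obtain ⟨rfl, -⟩ := hM.haltsWith_unique hσ ((hi.1 O x τ b).2 h)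
  rw [ho]
  exact hA x

/-- The proof system `proofSystem` is optimal: a proof `x` of another proof system, computed by
machine number `i`, is translated into the code of the computation on input `x`. -/
theorem hasPOptimalProofSystem_codingOracle
    (hE : ∀ M : OracleTM, M.Deterministic → ∃ i, M.Equivalent (E i)) (hA : Local A) (X : Oracle)
    {c : Bool} {z : Word} (hz : z ∈ A c (codingOracle E (Sound E A) X)) :
    HasPOptimalProofSystem (codingOracle E (Sound E A) X)
      (A c (codingOracle E (Sound E A) X)) := by
  set O := codingOracle E (Sound E A) X with hO
  have hval : ∀ {M : OracleTM} {i : ℕ} {f : Word → Word}, M.Deterministic → M.Equivalent (E i) →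
      M.Computes O f → (∀ x, f x ∈ A c O) → ∀ x τ b, M.HaltsWith O x τ b →
        proofSystem O c z (traceCode i x τ) = f x := by
    intro M i f hM hi hf hfA x τ b h
    have hmem : c :: true :: traceCode i x τ ∈ O :=
      cons_traceCode_mem hA (sound_of_computes hM hi hf hfA) ((hi.1 O x τ b).1 h)
    obtain ⟨σ, b', hσ, ho⟩ := OracleTM.computes_iff.1 hf x
    obtain ⟨rfl, -⟩ := hM.haltsWith_unique hσ h
    rw [proofSystem, if_pos hmem, decode_traceCode, ho]
  have hrange : Set.range (proofSystem O c z) = A c O := by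
    apply Set.Subset.antisymm
    · rintro _ ⟨w, rfl⟩
      rw [proofSystem]
      split_ifs with h
      · exact decode_mem hA h
      · exact hz
    · intro a ha
      obtain ⟨M, hM, hc⟩ := OracleTM.exists_computes_const a
      obtain ⟨i, hi⟩ := hE M hM
      obtain ⟨τ, b, hτ, -⟩ := OracleTM.computes_iff.1 (hc O) []
      exact ⟨traceCode i [] τ, hval hM hi (hc O) (fun _ => ha) [] τ b hτ⟩
  have hg := proofSystem_mem_classFP O c z
  refine ⟨proofSystem O c z, ⟨hg, hrange⟩, hg, fun f hf hfr => ?_⟩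
  obtain ⟨M, hM, hp, hc⟩ := hf
  obtain ⟨i, hi⟩ := hE M hM
  have hc' := OracleTM.computes_iff.1 hc
  choose τ b hτ _ using hc'
  have hπ := traceCode_mem_classFP hM hp i fun x => ⟨b x, hτ x⟩
  obtain ⟨p, hp⟩ := exists_polynomial_length_le hπ
  refine ⟨_, hπ, p, fun x => ⟨hp x, hval hM hi hc (fun x => ?_) x (τ x) (b x) (hτ x)⟩⟩
  rw [← hrange, ← hfr]
  exact ⟨x, rfl⟩

end Optimality

/-! ### The canonical complete set -/

theorem canonicalK_congr {pair : List Word → Word} (hpair : IsPairing pair) {M : ℕ+ → OracleTM}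
    {D D' : Oracle} {z : Word} (hD : ∀ u : Word, u.length < z.length → (u ∈ D ↔ u ∈ D'))
    (hz : z ∈ canonicalK pair M D) : z ∈ canonicalK pair M D' := by
  obtain ⟨i, t, x, rfl, h⟩ := hz
  refine ⟨i, t, x, rfl, h.congr fun u hu => hD u ?_⟩
  rw [hpair.length_eq]
  simp [zeros]
  omega

/-- The complete set `K^D` for the flag `true` and its complement for the flag `false`. -/
def targetSet (pair : List Word → Word) (M : ℕ+ → OracleTM) (c : Bool) (D : Oracle) : Set Word :=
  if c then canonicalK pair M D else (canonicalK pair M D)ᶜ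

theorem local_targetSet {pair : List Word → Word} (hpair : IsPairing pair) (M : ℕ+ → OracleTM) :
    Local (targetSet pair M) := by
  rintro (_ | _) D D' z hD
  · exact mt (canonicalK_congr hpair fun u hu => (hD u hu).symm)
  · exact canonicalK_congr hpair hD

theorem exists_mem_canonicalK {pair : List Word → Word} {M : ℕ+ → OracleTM}
    (hM : IsStandardEnumeration pair M) (D : Oracle) : ∃ z, z ∈ canonicalK pair M D := by
  let N : OracleTM :=
    { k := 0, State := Unit, Aux := Unit, finite_state := inferInstance,
      finite_aux := inferInstance, start := (), role := fun _ => .halt true }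
  have hN : N.PolyTime := by
    refine ⟨0, fun D x => ?_⟩
    rintro (_ | m) c h
    · exact Nat.zero_le _
    · obtain ⟨d, hd, -⟩ := h
      rw [OracleTM.next_halt (b := true) rfl] at hd
      cases hd
  obtain ⟨i, hi⟩ := (hM.infinite N hN).nonempty
  have h : ([] : Word) ∈ (M i).lang D := by
    rw [← hi D]
    exact ⟨0, 0, le_rfl, _, rfl, rfl⟩
  obtain ⟨t, ht⟩ := h
  exact ⟨_, i, t, [], rfl, ht⟩

theorem nil_code_notMem_canonicalK {pair : List Word → Word} (hpair : IsPairing pair)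
    (M : ℕ+ → OracleTM) (D : Oracle) : pair [] ∉ canonicalK pair M D := by
  rintro ⟨i, t, x, h, -⟩
  simpa using hpair.injective h

end OracleComplexity

theorem mainTheorem1 (pair : List OracleComplexity.Word → OracleComplexity.Word)
    (hpair : OracleComplexity.IsPairing pair)
    (M : ℕ+ → OracleComplexity.OracleTM)
    (hM : OracleComplexity.IsStandardEnumeration pair M) :
    ∃ O : OracleComplexity.Oracle,
      OracleComplexity.ClassP O ≠ OracleComplexity.ClassNP O ∧
      OracleComplexity.HasPOptimalProofSystem O (OracleComplexity.canonicalK pair M O) ∧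
      OracleComplexity.HasPOptimalProofSystem O (OracleComplexity.canonicalK pair M O)ᶜ := by
  open OracleComplexity in
  obtain ⟨E, hE, hE'⟩ := OracleTM.exists_enumeration
  have hA := local_targetSet hpair M
  obtain ⟨X, hX⟩ := exists_forall_lang_ne hE hE' hA
  refine ⟨codingOracle E (Sound E (targetSet pair M)) X, ?_, ?_, ?_⟩
  · intro h
    exact hX (h ▸ witnessLang_mem_classNP _)
  · obtain ⟨z, hz⟩ := exists_mem_canonicalK hM (codingOracle E (Sound E (targetSet pair M)) X)
    exact hasPOptimalProofSystem_codingOracle (c := true) hE' hA X hz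
  · exact hasPOptimalProofSystem_codingOracle (c := false) hE' hA X
      (nil_code_notMem_canonicalK hpair M _)
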